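/- Let $\mathbb K=\mathbb R$ or $\mathbb C$, and let $V$ be a vector space with basis $x^1,x^2,\dots$ and dual set $y_1,y_2,\dots\in V^*$. Let $\mathbb K[[V,\hbar]]$ be the completion of the polynomial ring $\mathbb K[x^1,x^2,\dots,\hbar]$ with respect to the ideal of polynomials without constant term, with grading $\deg x^i=1$, $\deg\hbar=2$. Let $\widehat{\mathcal W}_\hbar(V)$ be the completed Weyl algebra, i.e. the smallest algebra of operators on $\mathbb K[[V,\hbar]]$ that contains $\hbar$, all $x^i$, all $\hbar\partial_i$ and is closed under pointwise convergence; it is graded by $\deg x^i=\deg\hbar\partial_i=1$, $\deg \hbar=2$. Give $V^*$ the topology of pointwise convergence on $V$ (with $\mathbb K$ discrete). A quantum Airy structure on $V$ is a continuous linear map $L:V^*\to\widehat{\mathcal W}_\hbar(V)$ such that (1) the left ideal $\mathfrak L$ generated by $L(V^*)$ satisfies $[\mathfrak L,\mathfrak L]\subseteq\hbar\,\mathfrak L$, and (2) $L(y_i)=\hbar\partial_i+(\text{terms of degree}\ge2)$ for all $i$. It is quadratic if the maximal degree of the terms of the operators $L(\phi)$, $\phi\in V^*$, is $2$, and subalgebraic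 if $[L(V^*),L(V^*)]\subseteq\hbar\,L(V^*)$. Let $N\ge-1$ be an integer and $D_1,\dots,D_{N+1}\in\mathbb K$ arbitrary constants. For $r\in\mathbb Z_{\ge0}+\frac12$ put $b_r=\sqrt\hbar\,\partial_{r+\frac12}$ and $b_{-r}=\frac{r}{\sqrt\hbar}\,x^{r+\frac12}$ (only the elements $\sqrt\hbar\,b_{\pm r}$ of $\widehat{\mathcal W}_\hbar(V)$ are used), and let ${:}\;{:}$ denote normal ordering (modes with negative index to the left of those with positive index). Then $[\sqrt\hbar\, b_r,\sqrt\hbar\, b_s]=\hbar\, r\,\delta_{r,-s}$ for all $r,s\in\mathbb Z+\frac12$, the sums below converge in $\widehat{\mathcal W}_\hbar(V)$, and there is a unique continuous linear map $H:V^*\to\widehat{\mathcal W}_\hbar(V)$ with $$H_i:=H(y_i)=\hbar\partial_i+\frac\hbar2\sum_{r\in\mathbb Z+\frac12}{:}b_r\,b_{i+N-1-r}{:}+\frac{\hbar}{16}\,\delta_{i,1-N}+\hbar D_i\,\delta_{i\le N+1},\qquad i\ge1 .$$ It is a quantum Airy structure, it is quadratic and subalgebraic, and it represents the Virasoro subalgebra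 $$[H_i,H_j]=\hbar\,(i-j)\,H_{i+j+N-1},\qquad i,j\ge1$$ (for $N=-1$ and $i=j=1$ the right-hand side is read as $0$). Moreover, for $N=-1$ put $s=p=1$, and for $N=0$ suppose $D_1=0$ and put $s=p=0$. Then, in each of (a) and (b) separately, there are nonzero constants $c_k,\lambda_k$ ($k\ge0$) such that in the rescaled variables $t_k=c_kx^{k+1}$, writing $\partial_k=\partial/\partial t_k$, the following holds for all $k\ge0$. (a) $H_{k+1}=\lambda_k V_{k-s}$, where, with $(-1)!!=1$, $$V_n=\sum_{l\ge\max(0,-n)}\frac{(2l+2n+1)!!}{(2l-1)!!\,2^{n+1}}(t_l-\delta_{l,s})\,\hbar\partial_{l+n}+\frac{1}{2}\sum_{\substack{l,m\ge0\\ l+m=n-1}}\frac{(2l+1)!!(2m+1)!!}{2^{n+1}}\,\hbar^2\partial_l\partial_m+\frac{t_0^2}{2}\delta_{n,-1}+\frac{\hbar}{16}\delta_{n,0}$$ are ($\hbar$ times) the Virasoro operators of the Kontsevich--Witten tau function for $s=1$ ($n\ge-1$) and of the Brézin--Gross--Witten tau function for $s=0$ ($n\ge0$). (b) $H_{k+1}=\lambda_k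 L_k$, where $$L_k=\hbar\partial_k-\tfrac12\sum_{l,m\ge0}A_{klm}t_lt_m-\sum_{l,m\ge0}B_{kl}^m\,t_l\,\hbar\partial_m-\tfrac12\sum_{l,m\ge0}C_k^{lm}\hbar^2\partial_l\partial_m-\hbar \mathsf D_k$$ are the operators of the topological recursion on the spectral curve $x=z^2/2$, $\omega_{0,1}=-z^{2p}dz$ (the Airy curve $y=-z$ for $p=1$, the Bessel curve $y=-1/z$ for $p=0$), $\omega_{0,2}=\frac{dz_1dz_2}{(z_1-z_2)^2}$: with $\xi^*_k=\frac{z^{2k+1}}{2k+1}$, $\xi_k=\frac{(2k+1)dz}{z^{2k+2}}$ and $\theta=\frac{-2}{\omega_{0,1}(z)-\omega_{0,1}(-z)}$, $$A_{klm}=\operatorname*{Res}_{z=0}\xi^*_kd\xi^*_ld\xi^*_m\theta,\quad B_{kl}^m=\operatorname*{Res}_{z=0}\xi^*_kd\xi^*_l\xi_m\theta,\quad C_k^{lm}=\operatorname*{Res}_{z=0}\xi^*_k\xi_l\xi_m\theta,\quad \mathsf D_k=-\tfrac12\operatorname*{Res}_{z=0}\xi^*_k\,\omega_{0,2}(z,-z)\,\theta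 .$$ -/

import Mathlib

noncomputable section

namespace TwistedAiry

/-! ### The completed space of functions `𝕂[[V, ℏ]]`

`V` is the vector space with basis `x^1, x^2, …`. The generators of `𝕂[V, ℏ]` are indexed by
`Option ℕ+`: `some i` is the coordinate `x^i` and `none` is `ℏ`. -/

/-- The degrees of the generators: `deg x^i = 1`, `deg ℏ = 2`. -/
def genDeg : Option ℕ+ → ℕ
  | none => 2
  | some _ => 1

/-- The degree of a monomial in the `x^i` and `ℏ`. -/
def mdeg (m : Option ℕ+ →₀ ℕ) : ℕ := Finsupp.weight genDeg m

variable (K : Type*) [Field K]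

lemma mdeg_add (a b : Option ℕ+ →₀ ℕ) : mdeg (a + b) = mdeg a + mdeg b := by
  simp [mdeg]

/-- The completion of `𝕂[V, ℏ]` with respect to the ideal of polynomials without constant term,
realized as the algebra of formal series in the `x^i` and `ℏ` that have only finitely many monomials
in each degree (so that each homogeneous component is a polynomial). -/
def seriesAlg : Subalgebra K (MvPowerSeries (Option ℕ+) K) where
  carrier := {f | ∀ d : ℕ, {m | mdeg m = d ∧ MvPowerSeries.coeff m f ≠ 0}.Finite}
  mul_mem' := by
    classical
    intro f g hf hg d
    have hF : (⋃ e ∈ Set.Iic d, {m | mdeg m = e ∧ MvPowerSeries.coeff m f ≠ 0}).Finite :=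
      (Set.finite_Iic d).biUnion fun e _ => hf e
    have hG : (⋃ e ∈ Set.Iic d, {m | mdeg m = e ∧ MvPowerSeries.coeff m g ≠ 0}).Finite :=
      (Set.finite_Iic d).biUnion fun e _ => hg e
    refine (Set.Finite.image2 (fun a b => a + b) hF hG).subset ?_
    rintro m ⟨hm, hne⟩
    rw [MvPowerSeries.coeff_mul] at hne
    obtain ⟨p, hp, hpne⟩ := Finset.exists_ne_zero_of_sum_ne_zero hne
    replace hp : p.1 + p.2 = m := by simpa using hp
    have hd : mdeg p.1 + mdeg p.2 = d := by rw [← mdeg_add, hp, hm]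
    refine ⟨p.1, ?_, p.2, ?_, hp⟩
    · simp only [Set.mem_iUnion, Set.mem_Iic]
      exact ⟨mdeg p.1, by omega, rfl, left_ne_zero_of_mul hpne⟩
    · simp only [Set.mem_iUnion, Set.mem_Iic]
      exact ⟨mdeg p.2, by omega, rfl, right_ne_zero_of_mul hpne⟩
  add_mem' := by
    intro f g hf hg d
    refine ((hf d).union (hg d)).subset ?_
    rintro m ⟨hm, hne⟩
    by_cases h : MvPowerSeries.coeff m f = 0
    · right
      refine ⟨hm, fun h' => hne ?_⟩
      rw [map_add, h, h', add_zero]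
    · exact Or.inl ⟨hm, h⟩
  algebraMap_mem' := by
    classical
    intro r d
    refine (Set.finite_singleton (0 : Option ℕ+ →₀ ℕ)).subset ?_
    rintro m ⟨_, hne⟩
    by_contra h
    exact hne (by simp [MvPowerSeries.algebraMap_apply, MvPowerSeries.coeff_C,
      show m ≠ 0 from h])

/-- The algebra `𝕂[[V, ℏ]]`. -/
def Series : Type _ := seriesAlg K

instance : CommRing (Series K) := inferInstanceAs (CommRing (seriesAlg K))

instance : Algebra K (Series K) := inferInstanceAs (Algebra K (seriesAlg K))

variable {K}

/-- `𝕂[[V, ℏ]]^{≥ n}`. -/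
def Series.DegGE (n : ℕ) (f : Series K) : Prop :=
  ∀ m, mdeg m < n → MvPowerSeries.coeff m f.1 = 0

/-- `𝕂[[V, ℏ]]^{≤ n}`. -/
def Series.DegLE (n : ℕ) (f : Series K) : Prop :=
  ∀ m, n < mdeg m → MvPowerSeries.coeff m f.1 = 0

/-- The adic topology: the coarsest one for which all truncations of series to the monomials of
degree `< n` are continuous, the truncations being discrete. Two series are close if they agree up
to a high degree. -/
instance : TopologicalSpace (Series K) :=
  ⨅ n : ℕ, TopologicalSpace.induced
    (fun (f : Series K) (m : {m : Option ℕ+ →₀ ℕ // mdeg m < n}) => MvPowerSeries.coeff m.1 f.1) ⊥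

lemma X_mem (s : Option ℕ+) : MvPowerSeries.X s ∈ seriesAlg K := by
  classical
  intro d
  refine (Set.finite_singleton (Finsupp.single s 1)).subset ?_
  rintro m ⟨_, hne⟩
  by_contra h
  exact hne (by simp [MvPowerSeries.coeff_X, show m ≠ Finsupp.single s 1 from h])

lemma pderiv_mem (i : ℕ+) (f : Series K) :
    MvPowerSeries.pderiv K (some i) f.1 ∈ seriesAlg K := by
  intro d
  refine ((f.2 (d + 1)).preimage
    (f := fun m => m + Finsupp.single (some i) 1) (add_left_injective _).injOn).subset ?_
  rintro m ⟨hm, hne⟩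
  refine ⟨?_, fun h => hne ?_⟩
  · simp only [mdeg_add, hm]
    simp [mdeg, Finsupp.weight_single, genDeg]
  · rw [MvPowerSeries.coeff_pderiv]
    simp only at h
    rw [h, zero_mul]

/-! ### The completed Weyl algebra -/

variable (K) in
/-- Linear operators on `𝕂[[V, ℏ]]`. -/
abbrev Op : Type _ := Module.End K (Series K)

/-- The topology of pointwise convergence. -/
instance : TopologicalSpace (Op K) :=
  TopologicalSpace.induced (fun (T : Op K) (f : Series K) => T f) Pi.topologicalSpace

/-- Multiplication by `ℏ`. -/
def hbarOp : Op K := LinearMap.mulLeft K (⟨MvPowerSeries.X none, X_mem none⟩ : Series K)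

/-- Multiplication by `x^i`. -/
def xOp (i : ℕ+) : Op K := LinearMap.mulLeft K (⟨MvPowerSeries.X (some i), X_mem _⟩ : Series K)

/-- The partial derivative `∂_i`. -/
def dOp (i : ℕ+) : Op K where
  toFun f := ⟨MvPowerSeries.pderiv K (some i) f.1, pderiv_mem i f⟩
  map_add' f g := Subtype.ext (map_add (MvPowerSeries.pderiv K (some i)) f.1 g.1)
  map_smul' c f := Subtype.ext ((MvPowerSeries.pderiv K (some i)).map_smul c f.1)

/-- The generators `ℏ`, `x^i`, `ℏ ∂_i`. -/
def weylGenerators : Set (Op K) :=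
  {hbarOp} ∪ Set.range xOp ∪ Set.range (fun i => hbarOp * dOp i)

variable (K) in
/-- The completed Weyl algebra: the smallest algebra of operators on `𝕂[[V, ℏ]]` that
contains `ℏ`, all `x^i` and all `ℏ ∂_i`, and is closed for pointwise convergence. It consists of the
series `∑ ℏ^(|β|+k) c(k, α, β) x^α ∂^β`, where for each `β` and each degree `|α| + |β| + 2k` only
finitely many coefficients are nonzero. -/
def weylAlg : Subalgebra K (Op K) :=
  sInf {A : Subalgebra K (Op K) | weylGenerators ⊆ (A : Set (Op K)) ∧ IsClosed (A : Set (Op K))}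

variable (K) in
/-- The completed Weyl algebra of `V`, with the topology of pointwise convergence. -/
abbrev Weyl : Type _ := weylAlg K

lemma mem_weylAlg {T : Op K} (hT : T ∈ weylGenerators) : T ∈ weylAlg K := by
  rw [weylAlg, Algebra.mem_sInf]
  exact fun A hA => hA.1 hT

/-- `ℏ` -/
def hbar : Weyl K := ⟨hbarOp, mem_weylAlg (Or.inl (Or.inl rfl))⟩

/-- `x^i` -/
def x (i : ℕ+) : Weyl K := ⟨xOp i, mem_weylAlg (Or.inl (Or.inr ⟨i, rfl⟩))⟩

/-- `ℏ ∂_i` -/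
def hd (i : ℕ+) : Weyl K := ⟨hbarOp * dOp i, mem_weylAlg (Or.inr ⟨i, rfl⟩)⟩

/-- The elements of the Weyl algebra all of whose homogeneous components have degree `≥ n`. For
`deg x^i = deg (ℏ ∂_i) = 1`, `deg ℏ = 2`, a homogeneous operator of degree `d` is one that raises the
degree of series by `d`. -/
def Weyl.DegGE (n : ℕ) (T : Weyl K) : Prop :=
  ∀ (e : ℕ) (f : Series K), f.DegGE e → Series.DegGE (e + n) (T.1 f)

/-- The elements of the Weyl algebra all of whose homogeneous components have degree `≤ n`. -/
def Weyl.DegLE (n : ℕ) (T : Weyl K) : Prop :=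
  ∀ (e : ℕ) (f : Series K), f.DegLE e → Series.DegLE (e + n) (T.1 f)

/-! ### Quantum Airy structures -/

variable (K) in
/-- The dual space of `V`, where `V` has the basis `x^1, x^2, …`. -/
abbrev VDual : Type _ := Module.Dual K (ℕ+ →₀ K)

/-- The element `y_i` of the dual set of `x^1, x^2, …`. -/
def y (i : ℕ+) : VDual K := Finsupp.lapply i

/-- The topology on `V^*` of pointwise convergence of functionals on `V`, the field being
discrete. -/
@[reducible] def dualTopology : TopologicalSpace (VDual K) :=
  TopologicalSpace.induced (fun (u : VDual K) (a : ℕ+ →₀ K) => u a)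
    (@Pi.topologicalSpace _ _ fun _ => ⊥)

/-- Continuity of a linear operator from `V^*` to the completed Weyl algebra. -/
def IsContinuous (L : VDual K →ₗ[K] Weyl K) : Prop :=
  @Continuous _ _ dualTopology _ L

/-- The left ideal of the completed Weyl algebra generated by the image of `L`. -/
def leftIdeal (L : VDual K →ₗ[K] Weyl K) : Ideal (Weyl K) := Ideal.span (Set.range L)

/-- Quantum Airy structures on `V` (without fermionic variables). -/
structure IsQuantumAiryStructure (L : VDual K →ₗ[K] Weyl K) : Prop where
  continuous : IsContinuous L
  involutive : ∀ S ∈ leftIdeal L, ∀ T ∈ leftIdeal L, ∃ U ∈ leftIdeal L, S * T - T * S = hbar * U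
  /-- `L(y_i)` is `ℏ ∂_i` up to terms of degree at least two. -/
  linear_term : ∀ i, Weyl.DegGE 2 (L (y i) - hd i)

/-- The order of the operators is two. -/
def IsQuadratic (L : VDual K →ₗ[K] Weyl K) : Prop :=
  (∀ u, Weyl.DegLE 2 (L u)) ∧ ¬ ∀ u, Weyl.DegLE 1 (L u)

/-- The operators span a Lie algebra. -/
def IsSubalgebraic (L : VDual K →ₗ[K] Weyl K) : Prop :=
  ∀ u v, ∃ w, L u * L v - L v * L u = hbar * L w

/-! ### The twisted free boson -/

/-- The rescaled twisted bosonic modes: `J n` is `√ℏ b_r` for `r = n + 1/2`. So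
`√ℏ b_r = ℏ ∂_{r + 1/2}` and `√ℏ b_{-r} = r x^{r + 1/2}` for `r = 1/2, 3/2, …`. -/
def J : ℤ → Weyl K
  | Int.ofNat n => hd n.succPNat
  | Int.negSucc n => ((n : K) + 1 / 2) • x n.succPNat

/-- Normal ordered products `ℏ :b_r b_s:` for `r = a + 1/2`, `s = b + 1/2`: modes with a negative
index are on the left of those with a positive index. -/
def normalOrdered (a b : ℤ) : Weyl K := if 0 ≤ a ∧ b < 0 then J b * J a else J a * J b

/-- The term `ℏ :b_r b_{m-r}:` with `r = a + 1/2` (then `m - r = (m - 1 - a) + 1/2`). -/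
def virTerm (m a : ℤ) : Weyl K := normalOrdered a (m - 1 - a)

/-- `H_i = ℏ ∂_i + (ℏ/2) ∑_r :b_r b_{i+N-1-r}: + (ℏ/16) δ_{i,1-N} + ℏ D_i δ_{i ≤ N+1}`, the sum being
over all half-integers `r`. -/
def twistedH (N : ℤ) (D : ℕ+ → K) (i : ℕ+) : Weyl K :=
  hd i + (1 / 2 : K) • (∑' a : ℤ, virTerm (i + N - 1) a)
    + (if (i : ℤ) = 1 - N then (1 / 16 : K) • hbar else 0)
    + (if (i : ℤ) ≤ N + 1 then D i • hbar else 0)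

/-! ### Rescaled variables -/

/-- The rescaled variable `t_k = c_k x^{k+1}`, `k = 0, 1, …`. -/
def scaledX (c : ℕ → K) (k : ℕ) : Weyl K := c k • x k.succPNat

/-- `ℏ ∂/∂t_k` for `t_k = c_k x^{k+1}`. -/
def scaledD (c : ℕ → K) (k : ℕ) : Weyl K := (c k)⁻¹ • hd k.succPNat

/-! ### The Virasoro operators of Kontsevich-Witten and Brézin-Gross-Witten -/

/-- The KdV Virasoro operators, multiplied by `ℏ`, in the variables `t_0, t_1, …`:
`∑_k (2k+2n+1)!!/((2k-1)!! 2^{n+1}) (t_k - δ_{k,s}) ℏ ∂_{k+n}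
  + (1/2) ∑_{k+l=n-1} (2k+1)!! (2l+1)!!/2^{n+1} ℏ² ∂_k ∂_l + (t_0²/2) δ_{n,-1} + (ℏ/16) δ_{n,0}`.
For the dilaton shift `s = 1` and `n ≥ -1` these annihilate the Kontsevich-Witten tau function, for
`s = 0` and `n ≥ 0` the Brézin-Gross-Witten tau function. -/
def kdvVirasoro (s : ℕ) (c : ℕ → K) (n : ℤ) : Weyl K :=
  (∑' p : ℕ × ℕ, if (p.2 : ℤ) = p.1 + n then
      ((Nat.doubleFactorial (2 * p.2 + 1) : K) / ((Nat.doubleFactorial (2 * p.1 - 1) : K) * 2 ^ (n + 1))) •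
        ((scaledX c p.1 - if p.1 = s then 1 else 0) * scaledD c p.2) else 0)
    + (1 / 2 : K) • (∑' p : ℕ × ℕ, if (p.1 : ℤ) + p.2 = n - 1 then
      ((Nat.doubleFactorial (2 * p.1 + 1) : K) * (Nat.doubleFactorial (2 * p.2 + 1) : K) / 2 ^ (n + 1)) •
        (scaledD c p.1 * scaledD c p.2) else 0)
    + (if n = -1 then (1 / 2 : K) • (scaledX c 0 * scaledX c 0) else 0)
    + (if n = 0 then (1 / 16 : K) • hbar else 0)

/-! ### Topological recursion at a simple ramification point

The spectral curve is `x = z²/2` with the involution `z ↦ -z`, and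
`ω_{0,2} = dz₁ dz₂/(z₁ - z₂)²`. A form `f dz` is represented by the Laurent series `f`. -/

/-- The monomial `z^n`. -/
def zpow' (n : ℤ) : LaurentSeries K := HahnSeries.single n 1

/-- The residue at `z = 0` of `f dz`. -/
def residue (f : LaurentSeries K) : K := f.coeff (-1)

/-- The pull-back of the form `f dz` by `z ↦ -z`, that is, `-f(-z) dz`. -/
def pullback (f : LaurentSeries K) : LaurentSeries K where
  coeff n := -((-1) ^ n * f.coeff n)
  isPWO_support' := f.isPWO_support.mono fun n hn h => hn (by simp [h])

/-- The vector field `θ = -2 / (ω_{0,1}(z) - ω_{0,1}(-z))`. -/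
def theta (ω : LaurentSeries K) : LaurentSeries K := (-2) / (ω - pullback ω)

/-- `ξ_k = (2k+1) dz / z^{2k+2}` -/
def xi (k : ℕ) : LaurentSeries K := (2 * k + 1 : K) • zpow' (-(2 * k + 2))

/-- `ξ*_k = z^{2k+1}/(2k+1)` -/
def xiStar (k : ℕ) : LaurentSeries K := (2 * k + 1 : K)⁻¹ • zpow' (2 * k + 1)

/-- `d ξ*_k` -/
def dxiStar (k : ℕ) : LaurentSeries K := LaurentSeries.derivative K (xiStar k)

/-- `A_{ijk} = Res ξ*_i dξ*_j dξ*_k θ` -/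
def trA (ω : LaurentSeries K) (i j k : ℕ) : K :=
  residue (xiStar i * dxiStar j * dxiStar k * theta ω)

/-- `B_{ij}^k = Res ξ*_i dξ*_j ξ_k θ` -/
def trB (ω : LaurentSeries K) (i j k : ℕ) : K :=
  residue (xiStar i * dxiStar j * xi k * theta ω)

/-- `C_i^{jk} = Res ξ*_i ξ_j ξ_k θ` -/
def trC (ω : LaurentSeries K) (i j k : ℕ) : K :=
  residue (xiStar i * xi j * xi k * theta ω)

/-- `D_i = -(1/2) Res ξ*_i ω_{0,2}(z,-z) θ`, where `ω_{0,2}(z,-z) = -dz²/(4z²)`. -/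
def trD (ω : LaurentSeries K) (i : ℕ) : K :=
  -(1 / 2) * residue (xiStar i * ((-(1 / 4) : K) • zpow' (-2)) * theta ω)

/-- The operators of the quantum Airy structure associated to the topological recursion with
`ω_{0,1} = ω`, in the variables `t_0, t_1, …`:
`ℏ ∂_i - (1/2) A_{ijk} t_j t_k - B_{ij}^k t_j ℏ ∂_k - (1/2) C_i^{jk} ℏ² ∂_j ∂_k - ℏ D_i`. -/
def trOperator (ω : LaurentSeries K) (c : ℕ → K) (i : ℕ) : Weyl K :=
  scaledD c i
    - (1 / 2 : K) • (∑' p : ℕ × ℕ, trA ω i p.1 p.2 • (scaledX c p.1 * scaledX c p.2))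
    - (∑' p : ℕ × ℕ, trB ω i p.1 p.2 • (scaledX c p.1 * scaledD c p.2))
    - (1 / 2 : K) • (∑' p : ℕ × ℕ, trC ω i p.1 p.2 • (scaledD c p.1 * scaledD c p.2))
    - trD ω i • hbar

variable (K) in
/-- The Airy spectral curve `x = z²/2`, `y = -z`: `ω_{0,1} = y dx = -z² dz`. -/
def airyCurve : LaurentSeries K := -zpow' 2

variable (K) in
/-- The Bessel spectral curve `x = z²/2`, `y = -1/z`: `ω_{0,1} = y dx = -dz`. -/
def besselCurve : LaurentSeries K := -zpow' 0

end TwistedAiry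

end

open TwistedAiry

noncomputable section

namespace TwistedAiry

open Filter Topology

variable {K : Type*} [Field K]

/-! ### Degrees and the topology of `𝕂[[V, ℏ]]` -/

/-! In the notation of the proof, `H_i = J (i-1) + vir (i+N-1) + const • ℏ`, where `vir m` is half
the sum of the normally ordered products of modes. Everything rests on the relation `[vir m, J c] =
-(c + 1/2) ℏ J (m+c)`. By the Jacobi identity, `[vir m, vir n]` and `(m-n) ℏ vir (m+n)` have the
same commutator with every mode. An element of the completed Weyl algebra that commutes with all
`x^i` and kills the constant series `1` is zero, because polynomials are dense and the elements of
the algebra are continuous. So the central term can be read off from the action on `1`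
(`vir_commutator`). Only indices `≥ -1` are needed, and there only the pair `(-1, 1)` and its
reverse contribute. This contribution is what the constant `ℏ/16` in the zero mode absorbs. The
cross terms of `J` and `vir` yield `(i - 1/2) - (j - 1/2) = i - j` times the linear part. The
constants `D_i` are harmless, since the right-hand side contains `D_k` only for `i = j = 1`, where
its coefficient vanishes.

To pass from the `H_i` to a map on `V^*`, note that a given series has finitely many variables in
each degree, so `H_i f` tends to `0` and `∑ u_i H_i` converges. The `y_i` span a dense subspace of
`V^*`, which gives uniqueness and, with separate continuity of both sides, extends the bracket
relation to all functionals. The condition on the left ideal then follows from the Leibniz rule,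
since every commutator in the completed Weyl algebra is divisible by `ℏ` (`exists_commutator_eq`).

For the two integrable cases, `vir m` is split by the signs of its modes (`vir_eq`). With `ω_{0,1} =
-z^{2s} dz` all residues are of monomials, and what remains is a comparison of coefficients. It is
solved by rescalings involving `μ^(k-s)` with `μ^(2s+1) = 1/2`. -/

/-- The coefficient of a monomial, as a linear functional on `𝕂[[V, ℏ]]`. -/
def Series.coeff (m : Option ℕ+ →₀ ℕ) : Series K →ₗ[K] K where
  toFun f := MvPowerSeries.coeff m f.1
  map_add' f g := map_add (MvPowerSeries.coeff (R := K) m) f.1 g.1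
  map_smul' c f := (MvPowerSeries.coeff (R := K) m).map_smul c f.1

lemma Series.ext_coeff {f g : Series K} (h : ∀ m, Series.coeff m f = Series.coeff m g) : f = g :=
  Subtype.ext (MvPowerSeries.ext h)

lemma Series.degGE_iff {n : ℕ} {f : Series K} :
    f.DegGE n ↔ ∀ m, mdeg m < n → Series.coeff m f = 0 := Iff.rfl

lemma Series.degLE_iff {n : ℕ} {f : Series K} :
    f.DegLE n ↔ ∀ m, n < mdeg m → Series.coeff m f = 0 := Iff.rfl

variable (K) in
/-- The subspace `𝕂[[V, ℏ]]^{≥ n}`. -/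
def Series.geSubmodule (n : ℕ) : Submodule K (Series K) where
  carrier := {f | f.DegGE n}
  zero_mem' m _ := (Series.coeff m).map_zero
  add_mem' {f g} hf hg m hm := by
    rw [← zero_add (0 : K)]
    exact ((Series.coeff m).map_add f g).trans (congrArg₂ _ (hf m hm) (hg m hm))
  smul_mem' c f hf m hm := by
    rw [← smul_zero c]
    exact ((Series.coeff m).map_smul c f).trans (congrArg _ (hf m hm))

@[simp] lemma Series.mem_geSubmodule {n : ℕ} {f : Series K} :
    f ∈ Series.geSubmodule K n ↔ f.DegGE n := Iff.rfl

lemma Series.DegGE.mono {n k : ℕ} {f : Series K} (hf : f.DegGE n) (h : k ≤ n) : f.DegGE k :=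
  fun m hm => hf m (hm.trans_le h)

lemma Series.degGE_zero (f : Series K) : f.DegGE 0 := fun _ h => absurd h (Nat.not_lt_zero _)

lemma Series.eq_of_sub_degGE {f g : Series K} (h : ∀ n, (f - g).DegGE n) : f = g := by
  refine Series.ext_coeff fun m => sub_eq_zero.1 ?_
  rw [← map_sub]
  exact h (mdeg m + 1) m (Nat.lt_succ_self _)

/-- The topology is an infimum of topologies induced by discrete truncations, so convergence is
eventual agreement below each degree. The topological arguments below are reduced to this criterion.
-/
theorem Series.tendsto_iff {ι : Type*} {l : Filter ι} {u : ι → Series K} {f : Series K} :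
    Tendsto u l (𝓝 f) ↔ ∀ n, ∀ᶠ i in l, (u i - f).DegGE n := by
  rw [nhds_iInf, tendsto_iInf]
  refine forall_congr' fun n => ?_
  rw [@nhds_induced _ _ ⊥, @nhds_discrete _ ⊥ (@DiscreteTopology.mk _ ⊥ rfl), tendsto_comap_iff, tendsto_pure]
  refine eventually_congr (Eventually.of_forall fun i => ?_)
  simp only [Function.comp_apply, funext_iff, Subtype.forall]
  refine forall₂_congr fun m hm => ?_
  rw [← sub_eq_zero]
  exact ((Series.coeff m).map_sub (u i) f).symm ▸ Iff.rfl

instance : T2Space (Series K) := by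
  refine t2_iff_nhds.2 fun {f g} h => Series.eq_of_sub_degGE fun n => ?_
  have hf := Series.tendsto_iff.1 (tendsto_id.mono_left (inf_le_left : 𝓝 f ⊓ 𝓝 g ≤ 𝓝 f)) n
  have hg := Series.tendsto_iff.1 (tendsto_id.mono_left (inf_le_right : 𝓝 f ⊓ 𝓝 g ≤ 𝓝 g)) n
  obtain ⟨i, hi, hi'⟩ := (hf.and hg).exists
  have := (Series.geSubmodule K n).sub_mem hi' hi
  simpa using this

instance : IsTopologicalAddGroup (Series K) where
  continuous_add := continuous_iff_continuousAt.2 fun p => Series.tendsto_iff.2 fun n => by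
    have h1 := Series.tendsto_iff.1 (continuous_fst.tendsto p) n
    have h2 := Series.tendsto_iff.1 (continuous_snd.tendsto p) n
    filter_upwards [h1, h2] with q hq hq'
    have := (Series.geSubmodule K n).add_mem hq hq'
    rwa [← add_sub_add_comm] at this
  continuous_neg := continuous_iff_continuousAt.2 fun p => Series.tendsto_iff.2 fun n => by
    filter_upwards [Series.tendsto_iff.1 (continuous_id.tendsto p) n] with q hq
    have := (Series.geSubmodule K n).neg_mem hq
    rwa [neg_sub', id, id] at this

instance : ContinuousConstSMul K (Series K) where
  continuous_const_smul c := continuous_iff_continuousAt.2 fun p => Series.tendsto_iff.2 fun n => by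
    filter_upwards [Series.tendsto_iff.1 (continuous_id.tendsto p) n] with q hq
    have := (Series.geSubmodule K n).smul_mem c hq
    rwa [smul_sub] at this

/-- A linear map that does not lower degrees by more than a fixed amount is continuous. -/
theorem continuous_of_degGE (T : Op K) (d : ℕ)
    (hT : ∀ n (f : Series K), f.DegGE (n + d) → (T f).DegGE n) : Continuous T :=
  continuous_iff_continuousAt.2 fun f => Series.tendsto_iff.2 fun n => by
    filter_upwards [Series.tendsto_iff.1 (continuous_id.tendsto f) (n + d)] with g hg
    rw [← map_sub]
    exact hT n _ hg

theorem Series.isClosed_coeff_eq_zero (m : Option ℕ+ →₀ ℕ) :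
    IsClosed {f : Series K | Series.coeff m f = 0} := by
  refine isClosed_iff_forall_filter.2 fun f F _ hF hf => ?_
  have h1 := Series.tendsto_iff.1 (tendsto_id.mono_left hf) (mdeg m + 1)
  obtain ⟨g, hg, hg'⟩ := (h1.and (le_principal_iff.1 hF)).exists
  have := hg m (Nat.lt_succ_self _)
  change Series.coeff m (g - f) = 0 at this
  rw [map_sub, show Series.coeff m g = 0 from hg', zero_sub, neg_eq_zero] at this
  exact this

theorem Series.isClosed_degGE (n : ℕ) : IsClosed {f : Series K | f.DegGE n} := by
  simp only [Series.degGE_iff, Set.ofPred_forall]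
  exact isClosed_iInter fun m => isClosed_iInter fun _ => Series.isClosed_coeff_eq_zero m

theorem Series.isClosed_degLE (n : ℕ) : IsClosed {f : Series K | f.DegLE n} := by
  simp only [Series.degLE_iff, Set.ofPred_forall]
  exact isClosed_iInter fun m => isClosed_iInter fun _ => Series.isClosed_coeff_eq_zero m

theorem Series.summable_of_finite {ι : Type*} {g : ι → Series K}
    (h : ∀ n, {i | ¬ (g i).DegGE n}.Finite) : Summable g := by
  classical
  have hsum : ∀ (m : Option ℕ+ →₀ ℕ) (s : Finset ι), (h (mdeg m + 1)).toFinset ⊆ s →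
      Series.coeff m (∑ i ∈ s, g i) = ∑ᶠ i, Series.coeff m (g i) := by
    intro m s hs
    rw [map_sum, finsum_eq_sum_of_support_subset]
    intro i hi
    refine Finset.mem_coe.2 (hs ?_)
    simp only [Set.Finite.mem_toFinset, Set.mem_ofPred_eq]
    exact fun h' => hi (h' m (Nat.lt_succ_self _))
  -- The sum is formed coefficientwise. In degree `d` it agrees with one finite partial sum, hence
  -- has finitely many monomials there and is a legitimate element of the space.
  let G : Series K := ⟨fun m => ∑ᶠ i, Series.coeff m (g i), by
    intro d
    refine ((∑ i ∈ (h (d + 1)).toFinset, g i).2 d).subset ?_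
    rintro m ⟨rfl, hm⟩
    exact ⟨rfl, (hsum m _ subset_rfl).trans_ne hm⟩⟩
  refine ⟨G, Series.tendsto_iff.2 fun n => ?_⟩
  refine (eventually_ge_atTop (h n).toFinset).mono fun s hs m hm => ?_
  change Series.coeff m (∑ i ∈ s, g i - G) = 0
  rw [map_sub, hsum m s, sub_eq_zero]
  · rfl
  · refine Finset.Subset.trans ?_ hs
    exact Set.Finite.toFinset_subset_toFinset.2 fun i hi hi' => hi (hi'.mono hm)

/-! ### The topology of the completed Weyl algebra -/

theorem Op.tendsto_iff {ι : Type*} {l : Filter ι} {T : ι → Op K} {S : Op K} :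
    Tendsto T l (𝓝 S) ↔ ∀ f n, ∀ᶠ i in l, (T i f - S f).DegGE n := by
  rw [nhds_induced, tendsto_comap_iff, tendsto_pi_nhds]
  exact forall_congr' fun f => Series.tendsto_iff

theorem Op.continuous_apply (f : Series K) : Continuous fun T : Op K => T f :=
  (_root_.continuous_apply f).comp continuous_induced_dom

theorem Op.continuous_iff {X : Type*} [TopologicalSpace X] {T : X → Op K} :
    Continuous T ↔ ∀ f, Continuous fun a => T a f := by
  rw [continuous_induced_rng, continuous_pi_iff]
  rfl

instance : T2Space (Op K) :=
  T2Space.of_injective_continuous (f := fun (T : Op K) (f : Series K) => T f)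
    DFunLike.coe_injective continuous_induced_dom

instance : IsTopologicalAddGroup (Op K) where
  continuous_add := Op.continuous_iff.2 fun f =>
    ((Op.continuous_apply f).comp continuous_fst).add ((Op.continuous_apply f).comp continuous_snd)
  continuous_neg := Op.continuous_iff.2 fun f => (Op.continuous_apply f).neg

instance : ContinuousConstSMul K (Op K) where
  continuous_const_smul c := Op.continuous_iff.2 fun f => (Op.continuous_apply f).const_smul c

lemma Op.continuous_mul_right (S : Op K) : Continuous fun T : Op K => T * S :=
  Op.continuous_iff.2 fun f => Op.continuous_apply (S f)

lemma Op.continuous_mul_left {S : Op K} (hS : Continuous S) : Continuous fun T : Op K => S * T :=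
  Op.continuous_iff.2 fun f => hS.comp (Op.continuous_apply f)

theorem weylAlg_le {A : Subalgebra K (Op K)} (hA : weylGenerators ⊆ (A : Set (Op K)))
    (hcl : IsClosed (A : Set (Op K))) : weylAlg K ≤ A := sInf_le ⟨hA, hcl⟩

theorem isClosed_weylAlg : IsClosed (weylAlg K : Set (Op K)) := by
  rw [weylAlg, Algebra.coe_sInf]
  exact isClosed_biInter fun A hA => hA.2

variable (K) in
/-- The space of operators that raise degrees by at least `n`. -/
def Op.geSubmodule (n : ℕ) : Submodule K (Op K) where
  carrier := {T | ∀ (e : ℕ) (f : Series K), f.DegGE e → Series.DegGE (e + n) (T f)}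
  zero_mem' e _ _ := (Series.geSubmodule K (e + n)).zero_mem
  add_mem' hS hT e f hf := (Series.geSubmodule K (e + n)).add_mem (hS e f hf) (hT e f hf)
  smul_mem' c _ hT e f hf := (Series.geSubmodule K (e + n)).smul_mem c (hT e f hf)

variable (K) in
/-- The space of operators that raise degrees by at most `n`. -/
def Op.leSubmodule (n : ℕ) : Submodule K (Op K) where
  carrier := {T | ∀ (e : ℕ) (f : Series K), f.DegLE e → Series.DegLE (e + n) (T f)}
  zero_mem' e f _ m _ := (Series.coeff m).map_zero
  add_mem' {S T} hS hT e f hf m hm := by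
    rw [← zero_add (0 : K)]
    exact ((Series.coeff m).map_add (S f) (T f)).trans
      (congrArg₂ _ (hS e f hf m hm) (hT e f hf m hm))
  smul_mem' c T hT e f hf m hm := by
    rw [← smul_zero c]
    exact ((Series.coeff m).map_smul c (T f)).trans (congrArg _ (hT e f hf m hm))

lemma Op.isClosed_geSubmodule (n : ℕ) : IsClosed (Op.geSubmodule K n : Set (Op K)) := by
  change IsClosed {T : Op K | ∀ (e : ℕ) (f : Series K), f.DegGE e → Series.DegGE (e + n) (T f)}
  simp only [Set.ofPred_forall]
  exact isClosed_iInter fun e => isClosed_iInter fun f => isClosed_iInter fun _ =>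
    (Series.isClosed_degGE _).preimage (Op.continuous_apply f)

lemma Op.isClosed_leSubmodule (n : ℕ) : IsClosed (Op.leSubmodule K n : Set (Op K)) := by
  change IsClosed {T : Op K | ∀ (e : ℕ) (f : Series K), f.DegLE e → Series.DegLE (e + n) (T f)}
  simp only [Set.ofPred_forall]
  exact isClosed_iInter fun e => isClosed_iInter fun f => isClosed_iInter fun _ =>
    (Series.isClosed_degLE _).preimage (Op.continuous_apply f)

/-! ### The action of the generators on coefficients -/

variable (K) in
/-- The generators of `𝕂[[V, ℏ]]`. -/
def Series.gen (s : Option ℕ+) : Series K := (⟨MvPowerSeries.X s, X_mem s⟩ : seriesAlg K)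

lemma coeff_mulX (s : Option ℕ+) (m : Option ℕ+ →₀ ℕ) (f : Series K) :
    Series.coeff (m + Finsupp.single s 1)
      (Series.gen K s * f) = Series.coeff m f := by
  classical
  change MvPowerSeries.coeff _ (MvPowerSeries.X s * f.1) = _
  rw [add_comm, MvPowerSeries.X, MvPowerSeries.coeff_add_monomial_mul, one_mul]
  rfl

lemma coeff_mulX_eq_zero (s : Option ℕ+) {m : Option ℕ+ →₀ ℕ} (hm : m s = 0) (f : Series K) :
    Series.coeff m (Series.gen K s * f) = 0 := by
  classical
  change MvPowerSeries.coeff _ (MvPowerSeries.X s * f.1) = _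
  rw [MvPowerSeries.X, MvPowerSeries.coeff_monomial_mul, if_neg]
  intro h
  have := h s
  simp [hm] at this

lemma exists_add_single {s : Option ℕ+} {m : Option ℕ+ →₀ ℕ} (hm : m s ≠ 0) :
    ∃ m', m = m' + Finsupp.single s 1 :=
  ⟨m - Finsupp.single s 1, (tsub_add_cancel_of_le (by
    rw [Finsupp.single_le_iff]; omega)).symm⟩

lemma mdeg_single (s : Option ℕ+) : mdeg (Finsupp.single s 1) = genDeg s := by
  simp [mdeg, Finsupp.weight_single]

lemma degGE_mulX (s : Option ℕ+) {e : ℕ} {f : Series K} :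
    (Series.gen K s * f).DegGE (e + genDeg s) ↔ f.DegGE e := by
  constructor
  · intro hf m hm
    have := hf (m + Finsupp.single s 1) (by rw [mdeg_add, mdeg_single]; omega)
    exact (coeff_mulX s m f).symm.trans this
  · intro hf m hm
    by_cases h : m s = 0
    · exact coeff_mulX_eq_zero s h f
    · obtain ⟨m', rfl⟩ := exists_add_single h
      rw [mdeg_add, mdeg_single] at hm
      exact (coeff_mulX s m' f).trans (hf m' (by omega))

lemma degLE_mulX (s : Option ℕ+) {e : ℕ} {f : Series K} (hf : f.DegLE e) :
    (Series.gen K s * f).DegLE (e + genDeg s) := by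
  intro m hm
  by_cases h : m s = 0
  · exact coeff_mulX_eq_zero s h f
  · obtain ⟨m', rfl⟩ := exists_add_single h
    rw [mdeg_add, mdeg_single] at hm
    exact (coeff_mulX s m' f).trans (hf m' (by omega))

lemma coeff_dOp (i : ℕ+) (m : Option ℕ+ →₀ ℕ) (f : Series K) :
    Series.coeff m (dOp i f) =
      Series.coeff (m + Finsupp.single (some i) 1) f * ((m (some i) : K) + 1) :=
  MvPowerSeries.coeff_pderiv ..

lemma degGE_dOp (i : ℕ+) {e : ℕ} {f : Series K} (hf : f.DegGE (e + 1)) : (dOp i f).DegGE e := by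
  intro m hm
  change Series.coeff m (dOp i f) = 0
  rw [coeff_dOp]
  refine mul_eq_zero_of_left (hf _ ?_) _
  rw [mdeg_add, mdeg_single]
  exact Nat.add_lt_add_right hm 1

lemma degLE_dOp (i : ℕ+) {e : ℕ} {f : Series K} (hf : f.DegLE (e + 1)) : (dOp i f).DegLE e := by
  intro m hm
  change Series.coeff m (dOp i f) = 0
  rw [coeff_dOp]
  refine mul_eq_zero_of_left (hf _ ?_) _
  rw [mdeg_add, mdeg_single]
  exact Nat.add_lt_add_right hm 1

lemma hbarOp_mem_ge : (hbarOp : Op K) ∈ Op.geSubmodule K 2 :=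
  fun _ _ hf => (degGE_mulX none).2 hf

lemma xOp_mem_ge (i : ℕ+) : (xOp i : Op K) ∈ Op.geSubmodule K 1 :=
  fun _ _ hf => (degGE_mulX (some i)).2 hf

lemma hbarOp_mul_dOp_mem_ge (i : ℕ+) : (hbarOp * dOp i : Op K) ∈ Op.geSubmodule K 1 := by
  rintro (_ | e) f hf
  -- In degree `0` the derivative gives no lower bound, but multiplication by `ℏ` alone already
  -- raises the degree by two.
  · exact ((degGE_mulX none (e := 0)).2 (Series.degGE_zero _)).mono (by simp [genDeg])
  · exact (degGE_mulX none).2 (degGE_dOp i hf)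

lemma hbarOp_mem_le : (hbarOp : Op K) ∈ Op.leSubmodule K 2 :=
  fun _ _ hf => degLE_mulX none hf

lemma xOp_mem_le (i : ℕ+) : (xOp i : Op K) ∈ Op.leSubmodule K 1 :=
  fun _ _ hf => degLE_mulX (some i) hf

lemma hbarOp_mul_dOp_mem_le (i : ℕ+) : (hbarOp * dOp i : Op K) ∈ Op.leSubmodule K 1 := by
  rintro (_ | e) f hf
  -- A series of degree `≤ 0` is constant, so its derivatives vanish.
  · have : dOp i f = 0 := Series.ext_coeff fun m => by
      rw [coeff_dOp, map_zero]
      refine mul_eq_zero_of_left (hf _ ?_) _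
      rw [mdeg_add, mdeg_single, genDeg]
      omega
    intro m _
    rw [Module.End.mul_apply, this, map_zero]
    exact (Series.coeff m).map_zero
  · exact degLE_mulX none (degLE_dOp i hf)

/-- Elements of the completed Weyl algebra do not lower degrees. -/
theorem weylAlg_degGE {T : Op K} (hT : T ∈ weylAlg K) : T ∈ Op.geSubmodule K 0 := by
  let A : Subalgebra K (Op K) :=
    { carrier := Op.geSubmodule K 0
      mul_mem' := fun hS hT e f hf => hS e _ (hT e f hf)
      add_mem' := (Op.geSubmodule K 0).add_mem
      algebraMap_mem' := fun c e f hf => (Series.geSubmodule K (e + 0)).smul_mem c hf }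
  have mono : ∀ {n : ℕ} {T : Op K}, T ∈ Op.geSubmodule K n → T ∈ Op.geSubmodule K 0 :=
    fun h e f hf => (h e f hf).mono (by omega)
  refine weylAlg_le (A := A) ?_ (Op.isClosed_geSubmodule 0) hT
  rintro _ ((rfl | ⟨i, rfl⟩) | ⟨i, rfl⟩)
  exacts [mono hbarOp_mem_ge, mono (xOp_mem_ge i), mono (hbarOp_mul_dOp_mem_ge i)]

lemma Weyl.degGE_apply (T : Weyl K) {n : ℕ} {f : Series K} (hf : f.DegGE n) :
    (T.1 f).DegGE n := weylAlg_degGE T.2 n f hf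

lemma Weyl.continuous (T : Weyl K) : Continuous T.1 :=
  continuous_of_degGE T.1 0 fun _ _ hf => T.degGE_apply hf

theorem Weyl.tendsto_iff {ι : Type*} {l : Filter ι} {T : ι → Weyl K} {S : Weyl K} :
    Tendsto T l (𝓝 S) ↔ ∀ f n, ∀ᶠ i in l, ((T i).1 f - S.1 f).DegGE n := by
  rw [tendsto_subtype_rng, Op.tendsto_iff]

lemma Weyl.continuous_apply (f : Series K) : Continuous fun T : Weyl K => T.1 f :=
  (Op.continuous_apply f).comp continuous_subtype_val

instance : IsTopologicalRing (Weyl K) where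
  continuous_add := Continuous.subtype_mk
    ((continuous_subtype_val.comp continuous_fst).add
      (continuous_subtype_val.comp continuous_snd)) _
  continuous_neg := Continuous.subtype_mk continuous_subtype_val.neg _
  continuous_mul := continuous_iff_continuousAt.2 fun p => Weyl.tendsto_iff.2 fun f n => by
    have h1 := Weyl.tendsto_iff.1 (continuous_snd.tendsto p) f n
    have h2 := Weyl.tendsto_iff.1 (continuous_fst.tendsto p) (p.2.1 f) n
    filter_upwards [h1, h2] with q hq hq'
    -- Joint continuity of composition from `T'S'f - TSf = T'(S'f - Sf) + (T' - T)(Sf)`. The first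
    -- term is small because `T'` does not lower degrees, a bound uniform over the whole algebra.
    have h := (Series.geSubmodule K n).add_mem (q.1.degGE_apply hq) hq'
    rw [map_sub, sub_add_sub_cancel] at h
    exact h

instance : ContinuousConstSMul K (Weyl K) where
  continuous_const_smul c := Continuous.subtype_mk (continuous_subtype_val.const_smul c) _

/-- The sum exists pointwise as a linear operator, and it stays in the algebra because the algebra
is closed under pointwise limits. -/
theorem Weyl.summable_of_finite {ι : Type*} {T : ι → Weyl K}
    (h : ∀ f n, {i | ¬ ((T i).1 f).DegGE n}.Finite) : Summable T := by
  have hs : ∀ f, Summable fun i => (T i).1 f := fun f => Series.summable_of_finite (h f)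
  let S : Op K :=
    { toFun := fun f => ∑' i, (T i).1 f
      map_add' := fun f g => by
        simp only [map_add]
        exact (hs f).tsum_add (hs g)
      map_smul' := fun c f => by
        simp only [map_smul]
        exact (hs f).tsum_const_smul c }
  have hS : HasSum (fun i => (T i).1) S := by
    refine Op.tendsto_iff.2 fun f n => ?_
    filter_upwards [Series.tendsto_iff.1 (hs f).hasSum n] with s hs'
    rw [LinearMap.sum_apply]
    exact hs'
  have hmem : S ∈ weylAlg K := isClosed_weylAlg.mem_of_tendsto hS
    (Eventually.of_forall fun s => (weylAlg K).sum_mem fun i _ => (T i).2)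
  refine ⟨⟨S, hmem⟩, tendsto_subtype_rng.2 ?_⟩
  refine Tendsto.congr (fun s => ?_) hS
  exact (AddSubmonoidClass.coe_finsetSum _ _).symm

/-- Evaluation of the elements of the completed Weyl algebra at a series. -/
def Weyl.evalHom (f : Series K) : Weyl K →+ Series K where
  toFun T := T.1 f
  map_zero' := rfl
  map_add' _ _ := rfl

lemma Weyl.tsum_apply {ι : Type*} {T : ι → Weyl K} (h : Summable T) (f : Series K) :
    (∑' i, T i : Weyl K).1 f = ∑' i, (T i).1 f :=
  (h.hasSum.map (Weyl.evalHom f) (Weyl.continuous_apply f)).tsum_eq.symm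

/-! ### Commutators in the completed Weyl algebra -/

lemma hbarOp_mul_dOp (i : ℕ+) : (hbarOp * dOp i : Op K) = dOp i * hbarOp :=
  LinearMap.ext fun f => by
    refine Subtype.ext ?_
    change MvPowerSeries.X none * MvPowerSeries.pderiv K (some i) f.1 =
      MvPowerSeries.pderiv K (some i) (MvPowerSeries.X none * f.1)
    rw [Derivation.leibniz, MvPowerSeries.pderiv_X_of_ne (by simp)]
    simp

/-- The centralizer of `ℏ` is a subalgebra containing the generators, and it is closed because
multiplication by `ℏ` is continuous. -/
lemma hbarOp_commute {T : Op K} (hT : T ∈ weylAlg K) : hbarOp * T = T * hbarOp := by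
  let A := Subalgebra.centralizer K {(hbarOp : Op K)}
  have hA : IsClosed (A : Set (Op K)) := by
    have : (A : Set (Op K)) = {T | hbarOp * T = T * hbarOp} := by
      ext T; simp [A, Set.mem_centralizer_iff]
    rw [this]
    exact isClosed_eq (Op.continuous_mul_left (Weyl.continuous (hbar : Weyl K)))
      (Op.continuous_mul_right _)
  have := weylAlg_le (A := A) ?_ hA hT
  · simpa [A, Subalgebra.mem_centralizer_iff] using this
  have hx : ∀ i, (hbarOp : Op K) * xOp i = xOp i * hbarOp := fun i =>
    LinearMap.ext fun f => mul_left_comm _ _ f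
  rintro _ ((rfl | ⟨i, rfl⟩) | ⟨i, rfl⟩) <;>
    simp only [A, SetLike.mem_coe, Subalgebra.mem_centralizer_iff, Set.mem_singleton_iff, forall_eq]
  · exact hx i
  · rw [mul_assoc, hbarOp_mul_dOp]

lemma hbar_comm (T : Weyl K) : hbar * T = T * hbar := Subtype.ext (hbarOp_commute T.2)

/-- The ring structure of the completed Weyl algebra. -/
abbrev weylRing : Ring (Weyl K) :=
  { (inferInstance : Ring (Weyl K)) with toSemiring := (weylAlg K).toSemiring }

abbrev weylAddCommGroup : AddCommGroup (Weyl K) := weylRing.toAddCommGroup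

abbrev weylAddGroup : AddGroup (Weyl K) := weylAddCommGroup.toAddGroup

abbrev weylSubNegMonoid : SubNegMonoid (Weyl K) := weylAddGroup.toSubNegMonoid

abbrev weylSub : Sub (Weyl K) := weylRing.toSub

abbrev weylNeg : Neg (Weyl K) := weylRing.toNeg

attribute [local instance] weylRing weylAddCommGroup weylAddGroup weylSubNegMonoid weylSub weylNeg

/-- Division by `ℏ`, where the terms that are not divisible by `ℏ` are dropped. -/
def hbarDiv : Op K where
  toFun f := (⟨fun m => Series.coeff (m + Finsupp.single none 1) f, by
    intro d
    refine ((f.2 (d + 2)).preimage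
      (f := fun m => m + Finsupp.single none 1) (add_left_injective _).injOn).subset ?_
    rintro m ⟨hm, hne⟩
    refine ⟨?_, hne⟩
    change mdeg (m + Finsupp.single none 1) = d + 2
    rw [mdeg_add, mdeg_single, hm, genDeg]⟩ : seriesAlg K)
  map_add' f g := Series.ext_coeff fun m =>
    (Series.coeff (m + Finsupp.single none 1)).map_add f g
  map_smul' c f := Series.ext_coeff fun m =>
    (Series.coeff (m + Finsupp.single none 1)).map_smul c f

lemma continuous_hbarDiv : Continuous (hbarDiv : Op K) :=
  continuous_of_degGE _ 2 fun n f hf m hm => hf _ (by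
    rw [mdeg_add, mdeg_single, genDeg]; omega)

lemma hbarDiv_mul_hbarOp : (hbarDiv * hbarOp : Op K) = 1 :=
  LinearMap.ext fun f => Series.ext_coeff fun m => coeff_mulX none m f

/-- `hbarDiv` is a continuous left inverse of multiplication by `ℏ`, so divisibility of `T` is the
conjunction of two closed conditions: the quotient lies in the algebra, and multiplying it by `ℏ`
recovers `T`. -/
theorem isClosed_hbar_mul :
    IsClosed {T : Op K | ∃ U ∈ weylAlg K, T = hbarOp * U} := by
  have : {T : Op K | ∃ U ∈ weylAlg K, T = hbarOp * U} =
      {T | hbarDiv * T ∈ weylAlg K} ∩ {T | T = hbarOp * (hbarDiv * T)} := by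
    ext T
    constructor
    · rintro ⟨U, hU, rfl⟩
      have h : hbarDiv * (hbarOp * U) = U := by
        rw [← mul_assoc, hbarDiv_mul_hbarOp, one_mul]
      simpa only [Set.mem_inter_iff, Set.mem_ofPred_eq, h, and_true] using hU
    · rintro ⟨h1, h2⟩
      exact ⟨_, h1, h2⟩
  rw [this]
  have hc := Op.continuous_mul_left (continuous_hbarDiv (K := K))
  exact (isClosed_weylAlg.preimage hc).inter
    (isClosed_eq continuous_id
      ((Op.continuous_mul_left (Weyl.continuous (hbar : Weyl K))).comp hc))

lemma x_comm (i j : ℕ+) : (x i * x j : Weyl K) = x j * x i :=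
  Subtype.ext (LinearMap.ext fun f => mul_left_comm _ _ f)

lemma dOp_comm (i j : ℕ+) : (dOp i * dOp j : Op K) = dOp j * dOp i := by
  rcases eq_or_ne i j with rfl | h
  · rfl
  refine LinearMap.ext fun f => Series.ext_coeff fun m => ?_
  simp only [Module.End.mul_apply, coeff_dOp]
  have h1 : Finsupp.single (some i) 1 (some j) = 0 := by
    simp [h]
  have h2 : Finsupp.single (some j) 1 (some i) = 0 := by
    simp [h.symm]
  rw [Finsupp.add_apply, Finsupp.add_apply, h1, h2, add_right_comm]
  push_cast
  ring

lemma hd_comm (i j : ℕ+) : (hd i * hd j : Weyl K) = hd j * hd i := by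
  refine Subtype.ext ?_
  change (hbarOp * dOp i) * (hbarOp * dOp j) = (hbarOp * dOp j) * (hbarOp * dOp i)
  calc (hbarOp * dOp i) * (hbarOp * dOp j) = hbarOp * (dOp i * hbarOp) * dOp j := by
        simp only [mul_assoc]
    _ = hbarOp * hbarOp * (dOp i * dOp j) := by rw [← hbarOp_mul_dOp]; simp only [mul_assoc]
    _ = hbarOp * (hbarOp * dOp j) * dOp i := by rw [dOp_comm]; simp only [mul_assoc]
    _ = hbarOp * (dOp j * hbarOp) * dOp i := by rw [hbarOp_mul_dOp j]
    _ = (hbarOp * dOp j) * (hbarOp * dOp i) := by simp only [mul_assoc]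

lemma hd_mul_x (i j : ℕ+) :
    (hd i * x j : Weyl K) = x j * hd i + if i = j then hbar else 0 := by
  refine Subtype.ext (LinearMap.ext fun f => Subtype.ext ?_)
  have h : MvPowerSeries.pderiv K (some i) (MvPowerSeries.X (some j) * f.1) =
      MvPowerSeries.X (some j) * MvPowerSeries.pderiv K (some i) f.1 +
        if i = j then f.1 else 0 := by
    rw [Derivation.leibniz]
    split_ifs with hij
    · subst hij
      rw [MvPowerSeries.pderiv_X_self]
      simp
    · rw [MvPowerSeries.pderiv_X_of_ne (by simpa [eq_comm] using hij)]
      simp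
  have h' : (((hd i * x j : Weyl K)).1 f).1 = MvPowerSeries.X none *
    MvPowerSeries.pderiv K (some i) (MvPowerSeries.X (some j) * f.1) := rfl
  rw [h', h, mul_add, mul_left_comm]
  split_ifs
  · rfl
  · rw [mul_zero]
    rfl

/-- The commutators of the completed Weyl algebra are divisible by `ℏ`. -/
theorem exists_commutator_eq (S T : Weyl K) : ∃ U, S * T - T * S = hbar * U := by
  -- For fixed `S`, the `T` with commutator divisible by `ℏ` form a subalgebra by the Leibniz rule,
  -- closed by `isClosed_hbar_mul`. Hence it suffices to check generators, first in one argument and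
  -- then in the other.
  let A (S : Weyl K) : Subalgebra K (Op K) :=
    { carrier := {T | T ∈ weylAlg K ∧ ∃ U ∈ weylAlg K, S.1 * T - T * S.1 = hbarOp * U}
      mul_mem' := by
        rintro T T' ⟨hT, U, hU, h⟩ ⟨hT', U', hU', h'⟩
        refine ⟨mul_mem hT hT', U * T' + T * U', add_mem (mul_mem hU hT') (mul_mem hT hU'), ?_⟩
        calc S.1 * (T * T') - T * T' * S.1 =
            (S.1 * T - T * S.1) * T' + T * (S.1 * T' - T' * S.1) := by
              simp only [mul_sub, sub_mul, mul_assoc]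
              abel
          _ = hbarOp * (U * T') + T * hbarOp * U' := by rw [h, h']; simp only [mul_assoc]
          _ = hbarOp * (U * T' + T * U') := by
            rw [← hbarOp_commute hT, mul_add, mul_assoc]
      add_mem' := by
        rintro T T' ⟨hT, U, hU, h⟩ ⟨hT', U', hU', h'⟩
        refine ⟨add_mem hT hT', U + U', add_mem hU hU', ?_⟩
        rw [mul_add hbarOp, ← h, ← h', mul_add, add_mul]
        abel
      algebraMap_mem' := fun c =>
        ⟨(weylAlg K).algebraMap_mem c, 0, (weylAlg K).zero_mem, by
          rw [mul_zero, sub_eq_zero]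
          exact (Algebra.commutes c S.1).symm⟩ }
  have hA : ∀ S, IsClosed (A S : Set (Op K)) := fun S => isClosed_weylAlg.inter
    (isClosed_hbar_mul.preimage
      ((Op.continuous_mul_left S.continuous).sub (Op.continuous_mul_right S.1)))
  have key : ∀ S, (∀ T : Weyl K, T.1 ∈ weylGenerators → ∃ U, S * T - T * S = hbar * U) →
      ∀ T : Weyl K, ∃ U, S * T - T * S = hbar * U := by
    intro S hS T
    have := weylAlg_le (A := A S) ?_ (hA S) T.2
    · obtain ⟨_, U, hU, h⟩ := this
      exact ⟨⟨U, hU⟩, Subtype.ext h⟩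
    · intro T hT
      obtain ⟨U, hU⟩ := hS ⟨T, mem_weylAlg hT⟩ hT
      exact ⟨mem_weylAlg hT, U.1, U.2, congrArg Subtype.val hU⟩
  have swap : ∀ S T : Weyl K, (∃ U, S * T - T * S = hbar * U) →
      ∃ U, T * S - S * T = hbar * U := by
    rintro S T ⟨U, hU⟩
    exact ⟨-U, by rw [mul_neg, ← hU, neg_sub]⟩
  have gens : ∀ S T : Weyl K, S.1 ∈ weylGenerators → T.1 ∈ weylGenerators →
      ∃ U, S * T - T * S = hbar * U := by
    have hbar_left : ∀ T : Weyl K, ∃ U, hbar * T - T * hbar = hbar * U :=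
      fun T => ⟨0, by rw [hbar_comm, sub_self, mul_zero]⟩
    have hd_x : ∀ i j, ∃ U : Weyl K, hd i * x j - x j * hd i = hbar * U := fun i j =>
      ⟨if i = j then 1 else 0, by rw [hd_mul_x]; split_ifs <;> simp⟩
    rintro ⟨S, hS⟩ ⟨T, hT⟩ ((rfl | ⟨i, rfl⟩) | ⟨i, rfl⟩) hT'
    · exact hbar_left _
    all_goals rcases hT' with ((rfl | ⟨j, rfl⟩) | ⟨j, rfl⟩)
    · exact swap _ _ (hbar_left _)
    · exact ⟨0, by rw [mul_zero, sub_eq_zero]; exact x_comm i j⟩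
    · exact swap _ _ (hd_x j i)
    · exact swap _ _ (hbar_left _)
    · exact hd_x i j
    · exact ⟨0, by rw [mul_zero, sub_eq_zero]; exact hd_comm i j⟩
  exact key S (fun T hT => swap _ _ (key T (fun S hS => gens T S hT hS) S)) T

/-! ### Operators that commute with the coordinates -/

variable (K) in
/-- The monomials of `𝕂[[V, ℏ]]`. -/
def Series.mon (m : Option ℕ+ →₀ ℕ) : Series K :=
  (⟨MvPowerSeries.monomial m 1, by
    classical
    intro d
    refine (Set.finite_singleton m).subset ?_
    rintro m' ⟨_, hne⟩
    by_contra h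
    exact hne (by rw [MvPowerSeries.coeff_monomial, if_neg (by simpa using h)])⟩ : seriesAlg K)

lemma Series.coeff_mon [DecidableEq (Option ℕ+ →₀ ℕ)] (m m' : Option ℕ+ →₀ ℕ) :
    Series.coeff m (Series.mon K m') = if m = m' then 1 else 0 := by
  classical
  refine (MvPowerSeries.coeff_monomial m m' (1 : K)).trans ?_
  congr

lemma Series.mon_zero : Series.mon K 0 = 1 := rfl

lemma Series.mon_add_single (m : Option ℕ+ →₀ ℕ) (s : Option ℕ+) :
    Series.mon K (m + Finsupp.single s 1) = Series.gen K s * Series.mon K m := by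
  refine Subtype.ext ?_
  change MvPowerSeries.monomial _ 1 = MvPowerSeries.X s * MvPowerSeries.monomial m 1
  rw [MvPowerSeries.X, MvPowerSeries.monomial_mul_monomial, one_mul, add_comm]

lemma Series.finite_support (f : Series K) (n : ℕ) :
    {m | mdeg m < n ∧ Series.coeff m f ≠ 0}.Finite := by
  refine ((Set.finite_Iio n).biUnion fun d _ => f.2 d).subset ?_
  rintro m ⟨hm, h⟩
  simp only [Set.mem_iUnion, Set.mem_Iio]
  exact ⟨mdeg m, hm, rfl, h⟩

/-- Density of the polynomials: the truncation of `f` below degree `n` has finitely many terms. -/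
theorem Series.exists_mem_span_mon (f : Series K) (n : ℕ) :
    ∃ g ∈ Submodule.span K (Set.range (Series.mon K)), (f - g).DegGE n := by
  classical
  refine ⟨∑ m ∈ (f.finite_support n).toFinset, Series.coeff m f • Series.mon K m,
    Submodule.sum_mem _ fun m _ => Submodule.smul_mem _ _ (Submodule.subset_span ⟨m, rfl⟩), ?_⟩
  intro m hm
  change Series.coeff m (_ - _) = 0
  rw [map_sub, map_sum, sub_eq_zero]
  simp only [map_smul, Series.coeff_mon, smul_eq_mul, mul_ite, mul_one, mul_zero,
    Finset.sum_ite_eq, Set.Finite.mem_toFinset, Set.mem_ofPred_eq]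
  split_ifs with h
  · rfl
  · by_contra h'
    exact h ⟨hm, h'⟩

/-- An element of the Weyl algebra that commutes with all coordinates and annihilates `1` is zero. -/
theorem Weyl.eq_zero_of_commute_x {T : Weyl K} (h1 : T.1 1 = 0)
    (hx : ∀ i, T * x i = x i * T) : T = 0 := by
  have hgen : ∀ (s : Option ℕ+) (f : Series K),
      T.1 (Series.gen K s * f) = Series.gen K s * T.1 f := by
    rintro (_ | i) f
    · exact LinearMap.congr_fun (congrArg Subtype.val (hbar_comm T)).symm f
    · exact LinearMap.congr_fun (congrArg Subtype.val (hx i)) f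
  -- Each nonconstant monomial is a generator times a monomial of lower degree, and `T` commutes
  -- with all generators, `ℏ` included.
  have hmon : ∀ n m, mdeg m = n → T.1 (Series.mon K m) = 0 := by
    intro n
    induction n using Nat.strong_induction_on with
    | _ n ih =>
      intro m hm
      by_cases h : m = 0
      · rw [h]; exact h1
      · obtain ⟨s, hs⟩ := Finsupp.ne_iff.1 h
        obtain ⟨m', rfl⟩ := exists_add_single hs
        rw [mdeg_add, mdeg_single] at hm
        have hpos : 0 < genDeg s := by cases s <;> simp [genDeg]
        rw [Series.mon_add_single, hgen, ih (mdeg m') (by omega) m' rfl, mul_zero]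
  have hspan : ∀ g ∈ Submodule.span K (Set.range (Series.mon K)), T.1 g = 0 := by
    intro g hg
    have : Submodule.span K (Set.range (Series.mon K)) ≤ LinearMap.ker T.1 := by
      rw [Submodule.span_le]
      rintro _ ⟨m, rfl⟩
      exact hmon _ m rfl
    exact this hg
  refine Subtype.ext (LinearMap.ext fun f => Series.eq_of_sub_degGE fun n => ?_)
  obtain ⟨g, hg, hfg⟩ := f.exists_mem_span_mon n
  have := T.degGE_apply hfg
  rw [map_sub, hspan g hg, sub_zero] at this
  simpa using this

/-! ### The bosonic modes -/

lemma J_natCast (n : ℕ) : (J (n : ℤ) : Weyl K) = hd n.succPNat := rfl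

lemma J_negSucc (n : ℕ) : (J (Int.negSucc n) : Weyl K) = ((n : K) + 1 / 2) • x n.succPNat := rfl

lemma succPNat_eq_iff {m n : ℕ} : m.succPNat = n.succPNat ↔ m = n :=
  Nat.succPNat_injective.eq_iff

/-- The Heisenberg relations. -/
theorem J_commutator [CharZero K] (a b : ℤ) : (J a * J b - J b * J a : Weyl K) =
    if a + b + 1 = 0 then ((a : K) + 1 / 2) • hbar else 0 := by
  have key : ∀ m n : ℕ, (J (m : ℤ) * J (Int.negSucc n) - J (Int.negSucc n) * J (m : ℤ) : Weyl K) =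
      if m = n then ((m : K) + 1 / 2) • hbar else 0 := by
    intro m n
    rw [J_natCast, J_negSucc, mul_smul_comm, smul_mul_assoc, hd_mul_x, smul_add, add_sub_cancel_left]
    simp only [succPNat_eq_iff]
    split_ifs with h
    · rw [h]
    · exact smul_zero _
  rcases a with m | m <;> rcases b with n | n
  · rw [if_neg (by simp only [Int.ofNat_eq_natCast]; omega), sub_eq_zero]
    exact hd_comm _ _
  · refine (key m n).trans ?_
    have : (Int.ofNat m + Int.negSucc n + 1 = 0) ↔ m = n := by
      simp only [Int.ofNat_eq_natCast]; omega
    rw [if_congr this rfl rfl, Int.ofNat_eq_natCast, Int.cast_natCast]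
  · have h := key n m
    rw [← neg_sub, ← Int.ofNat_eq_natCast] at h
    rw [← neg_neg (J _ * J _ - _), h]
    have : (Int.negSucc m + Int.ofNat n + 1 = 0) ↔ n = m := by
      simp only [Int.ofNat_eq_natCast]; omega
    simp only [this]
    split_ifs with h
    · subst h
      rw [← neg_smul]
      congr 1
      push_cast [Int.cast_negSucc]
      ring
    · exact neg_zero
  · rw [if_neg (by omega), sub_eq_zero, J_negSucc, J_negSucc]
    simp only [smul_mul_assoc, mul_smul_comm, x_comm m.succPNat]
    rw [smul_comm]

lemma J_mul [CharZero K] (a b : ℤ) : (J a * J b : Weyl K) =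
    J b * J a + if a + b + 1 = 0 then ((a : K) + 1 / 2) • hbar else 0 := by
  rw [← J_commutator, add_sub_cancel]

/-- Modes of the same sign commute, so the larger index may always be placed on the right. That mode
acts first, and the degree estimates and the action on `1` are controlled by it. -/
lemma normalOrdered_eq [CharZero K] (a b : ℤ) :
    (normalOrdered a b : Weyl K) = J (min a b) * J (max a b) := by
  rw [normalOrdered]
  split_ifs with h
  · rw [min_eq_right (by omega), max_eq_left (by omega)]
  · rcases le_total a b with hab | hab
    · rw [min_eq_left hab, max_eq_right hab]
    · rw [min_eq_right hab, max_eq_left hab, J_mul, if_neg (by omega), add_zero]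

/-- Only finitely many variables occur in the low-degree part of `f`, and `∂_i` kills this part for
all other `i`. -/
theorem finite_not_degGE_hd (f : Series K) (n : ℕ) :
    {i : ℕ+ | ¬ ((hd i : Weyl K).1 f).DegGE n}.Finite := by
  refine ((f.finite_support (n + 1)).biUnion (t := fun m => {i : ℕ+ | some i ∈ m.support})
    fun m _ => ?_).subset ?_
  · exact m.support.finite_toSet.preimage (Option.some_injective _).injOn
  · intro i hi
    by_contra h
    refine hi ?_
    refine Series.DegGE.mono ((degGE_mulX none (e := n) (f := dOp i f)).2 fun m hm => ?_) (by omega)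
    change Series.coeff m (dOp i f) = 0
    rw [coeff_dOp]
    refine mul_eq_zero_of_left ?_ _
    by_contra h'
    refine h (Set.mem_biUnion (x := m + Finsupp.single (some i) 1) ⟨?_, h'⟩ ?_)
    · rw [mdeg_add, mdeg_single, genDeg]
      omega
    · simp

theorem exists_forall_degGE_hd (f : Series K) (n : ℕ) :
    ∃ M : ℕ, ∀ i : ℕ+, M ≤ i → ((hd i : Weyl K).1 f).DegGE n := by
  obtain ⟨M, hM⟩ := (finite_not_degGE_hd f n).bddAbove
  refine ⟨M + 1, fun i hi => ?_⟩
  by_contra h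
  have : (i : ℕ) ≤ M := hM h
  omega

theorem exists_forall_degGE_J (f : Series K) (n : ℕ) :
    ∃ M : ℤ, ∀ a, M ≤ a → ((J a : Weyl K).1 f).DegGE n := by
  obtain ⟨M, hM⟩ := exists_forall_degGE_hd f n
  refine ⟨M, fun a ha => ?_⟩
  lift a to ℕ using by omega
  exact hM _ (by rw [Nat.succPNat_coe]; omega)

lemma Weyl.mul_apply (S T : Weyl K) (f : Series K) : (S * T).1 f = S.1 (T.1 f) := rfl

/-- The bound is uniform in `m`: it serves both the convergence of each sum `vir m` and the decay of
`vir m` as `m` grows. -/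
theorem exists_forall_degGE_virTerm [CharZero K] (f : Series K) (n : ℕ) :
    ∃ M : ℤ, ∀ m a, M ≤ max a (m - 1 - a) → ((virTerm m a : Weyl K).1 f).DegGE n := by
  obtain ⟨M, hM⟩ := exists_forall_degGE_J f n
  refine ⟨M, fun m a h => ?_⟩
  rw [virTerm, normalOrdered_eq, Weyl.mul_apply]
  exact Weyl.degGE_apply _ (hM _ h)

theorem summable_virTerm [CharZero K] (m : ℤ) :
    Summable fun a : ℤ => (virTerm m a : Weyl K) := by
  refine Weyl.summable_of_finite fun f n => ?_
  obtain ⟨M, hM⟩ := exists_forall_degGE_virTerm f n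
  refine (Set.finite_Ioo (m - 1 - M) M).subset fun a ha => ?_
  have : ¬ M ≤ max a (m - 1 - a) := fun h => ha (hM m a h)
  rw [Set.mem_Ioo]
  omega

/-! ### The Virasoro algebra of the twisted modes -/

/-- The Virasoro modes `(ℏ/2) ∑_r :b_r b_{m-r}:`, up to the constant term of the zero mode. -/
def vir (m : ℤ) : Weyl K := (1 / 2 : K) • ∑' a : ℤ, virTerm m a

lemma intCast_add_half_ne_zero [CharZero K] (c : ℤ) : (c : K) + 1 / 2 ≠ 0 := by
  intro h
  have h2 : ((2 * c + 1 : ℤ) : K) = 0 := by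
    push_cast
    linear_combination 2 * h
  have := Int.cast_eq_zero.1 h2
  omega

lemma natCast_add_half_ne_zero [CharZero K] (n : ℕ) : (n : K) + 1 / 2 ≠ 0 := by
  simpa using intCast_add_half_ne_zero (K := K) n

lemma x_eq_smul_J [CharZero K] (n : ℕ) :
    (x n.succPNat : Weyl K) = ((n : K) + 1 / 2)⁻¹ • J (Int.negSucc n) := by
  rw [J_negSucc, smul_smul, inv_mul_cancel₀ (natCast_add_half_ne_zero n), one_smul]

lemma J_mul_J_commutator [CharZero K] (a b c : ℤ) :
    (J a * J b * J c - J c * (J a * J b) : Weyl K) =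
      (if b + c + 1 = 0 then ((b : K) + 1 / 2) • (hbar * J a) else 0) +
      (if a + c + 1 = 0 then ((a : K) + 1 / 2) • (hbar * J b) else 0) := by
  have h : (J a * J b * J c - J c * (J a * J b) : Weyl K) =
      J a * (J b * J c - J c * J b) + (J a * J c - J c * J a) * J b := by noncomm_ring
  rw [h, J_commutator, J_commutator, mul_ite, ite_mul, mul_smul_comm, smul_mul_assoc, mul_zero,
    zero_mul, hbar_comm (J a)]

/-- The two orderings differ by a multiple of the central element `ℏ`, so commutators do not see
normal ordering. -/
lemma normalOrdered_commutator [CharZero K] (a b c : ℤ) :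
    (normalOrdered a b * J c - J c * normalOrdered a b : Weyl K) =
      (if b + c + 1 = 0 then ((b : K) + 1 / 2) • (hbar * J a) else 0) +
      (if a + c + 1 = 0 then ((a : K) + 1 / 2) • (hbar * J b) else 0) := by
  rw [normalOrdered]
  by_cases h : 0 ≤ a ∧ b < 0
  · rw [if_pos h, J_mul_J_commutator, add_comm]
  · rw [if_neg h, J_mul_J_commutator]

/-- In the sum over `a` only `a = m + c` and `a = -1 - c` survive. Their contributions are equal,
which cancels the factor `1/2`. -/
theorem vir_commutator_J [CharZero K] (m c : ℤ) :
    (vir m * J c - J c * vir m : Weyl K) = -(((c : K) + 1 / 2) • (hbar * J (m + c))) := by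
  have h1 := ((summable_virTerm (K := K) m).hasSum.mul_right (J c)).sub
    ((summable_virTerm m).hasSum.mul_left (J c))
  have h2 : HasSum (fun a : ℤ => (virTerm m a * J c - J c * virTerm m a : Weyl K))
      (-(((c : K) + 1 / 2) • (hbar * J (m + c))) + -(((c : K) + 1 / 2) • (hbar * J (m + c)))) := by
    refine ((hasSum_ite_eq (m + c) _).add (hasSum_ite_eq (-1 - c) _)).congr_fun ?_
    intro a
    rw [virTerm, normalOrdered_commutator]
    congr 1
    · by_cases h : a = m + c
      · subst h
        rw [if_pos (by ring), if_pos rfl, ← neg_smul]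
        congr 1
        push_cast
        ring
      · rw [if_neg (by omega), if_neg h]
    · by_cases h : a = -1 - c
      · subst h
        rw [if_pos (by ring), if_pos rfl, ← neg_smul, show m - 1 - (-1 - c) = m + c by ring]
        congr 1
        push_cast
        ring
      · rw [if_neg (by omega), if_neg h]
  have h3 := h1.unique h2
  rw [vir, smul_mul_assoc, mul_smul_comm, ← smul_sub, h3]
  module

/-- The Jacobi identity. -/
lemma Weyl.commutator_commutator (A B T : Weyl K) :
    (A * B - B * A) * T - T * (A * B - B * A) =
      (A * (B * T - T * B) - (B * T - T * B) * A) -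
        (B * (A * T - T * A) - (A * T - T * A) * B) := by noncomm_ring

lemma vir_commutator_hbar_mul_J [CharZero K] (m c : ℤ) :
    (vir m * (hbar * J c) - (hbar * J c) * vir m : Weyl K) =
      -(((c : K) + 1 / 2) • (hbar * hbar * J (m + c))) := by
  rw [← mul_assoc, ← hbar_comm, mul_assoc, mul_assoc, ← mul_sub, vir_commutator_J, mul_neg,
    mul_smul_comm, ← mul_assoc]

/-- The result is also the commutator of `(m - n) ℏ vir (m + n)` with `J c`, so the Virasoro
relation holds up to an element commuting with all modes. -/
theorem vir_commutator_commutator_J [CharZero K] (m n c : ℤ) :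
    ((vir m * vir n - vir n * vir m) * J c - J c * (vir m * vir n - vir n * vir m) : Weyl K) =
      -((((m : K) - n) * ((c : K) + 1 / 2)) • (hbar * hbar * J (m + n + c))) := by
  rw [Weyl.commutator_commutator, vir_commutator_J, vir_commutator_J, mul_neg, neg_mul, mul_neg,
    neg_mul, mul_smul_comm, smul_mul_assoc, mul_smul_comm, smul_mul_assoc, sub_neg_eq_add,
    sub_neg_eq_add, neg_add_eq_sub, neg_add_eq_sub, ← smul_sub, ← smul_sub,
    ← neg_sub (vir n * _), ← neg_sub (vir m * _),
    vir_commutator_hbar_mul_J, vir_commutator_hbar_mul_J, show n + (m + c) = m + n + c by ring,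
    ← add_assoc]
  push_cast
  module

lemma hd_apply_one (i : ℕ+) : (hd i : Weyl K).1 1 = 0 := by
  have : (dOp i : Op K) 1 = 0 := Subtype.ext MvPowerSeries.pderiv_one
  exact (congrArg hbarOp this).trans (map_zero _)

lemma J_apply_one {a : ℤ} (ha : 0 ≤ a) : (J a : Weyl K).1 1 = 0 := by
  lift a to ℕ using ha
  exact hd_apply_one _

lemma virTerm_apply_one [CharZero K] {m a : ℤ} (h : 0 ≤ max a (m - 1 - a)) :
    (virTerm m a : Weyl K).1 1 = 0 := by
  rw [virTerm, normalOrdered_eq, Weyl.mul_apply, J_apply_one h, map_zero]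

lemma vir_apply [CharZero K] (m : ℤ) (f : Series K) :
    (vir m : Weyl K).1 f = (1 / 2 : K) • ∑' a : ℤ, (virTerm m a : Weyl K).1 f := by
  rw [← Weyl.tsum_apply (summable_virTerm m)]
  rfl

lemma vir_apply_one [CharZero K] {m : ℤ} (hm : 0 ≤ m) : (vir m : Weyl K).1 1 = 0 := by
  rw [vir_apply, tsum_congr fun a => virTerm_apply_one (by omega), tsum_zero, smul_zero]

lemma vir_neg_one_apply_one [CharZero K] :
    (vir (-1) : Weyl K).1 1 = (1 / 2 : K) • (J (-1) * J (-1) : Weyl K).1 1 := by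
  rw [vir_apply, tsum_eq_single (-1) fun a ha => virTerm_apply_one (by omega)]
  rfl

lemma vir_apply_vir_neg_one_apply_one [CharZero K] {n : ℤ} (hn : 0 ≤ n) :
    (vir n : Weyl K).1 ((vir (-1) : Weyl K).1 1) = (1 / 4 : K) •
      (hbar.1 ((J (n - 1) * J (-1) : Weyl K).1 1) +
        hbar.1 ((J (-1) * J (n - 1) : Weyl K).1 1)) := by
  -- Moving `vir n` to the right past both modes leaves a term ending in `vir n`, which kills `1`.
  have h' : (vir n * (J (-1) * J (-1)) : Weyl K) =
      (vir n * J (-1) - J (-1) * vir n) * J (-1) + J (-1) * (vir n * J (-1) - J (-1) * vir n)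
        + J (-1) * J (-1) * vir n := by noncomm_ring
  rw [vir_commutator_J, neg_mul, mul_neg, smul_mul_assoc, mul_smul_comm, ← mul_assoc (J (-1)) hbar,
    ← hbar_comm, mul_assoc, mul_assoc] at h'
  have h := LinearMap.congr_fun (congrArg Subtype.val h') 1
  rw [vir_neg_one_apply_one, map_smul, ← Weyl.mul_apply, h]
  change (1 / 2 : K) • (-((((-1 : ℤ) : K) + 1 / 2) • hbar.1 ((J (n - 1) * J (-1) : Weyl K).1 1)) +
    -((((-1 : ℤ) : K) + 1 / 2) • hbar.1 ((J (-1) * J (n - 1) : Weyl K).1 1)) +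
    (J (-1)).1 ((J (-1) : Weyl K).1 ((vir n : Weyl K).1 1))) = _
  rw [vir_apply_one hn, map_zero, map_zero]
  push_cast
  module

lemma J_mul_J_neg_one_apply_one [CharZero K] {n : ℤ} (hn : 0 ≤ n) :
    (J n * J (-1) : Weyl K).1 1 = if n = 0 then (1 / 2 : K) • hbar.1 1 else 0 := by
  rw [J_mul]
  have e : ∀ A B C : Weyl K, (A * B + C).1 1 = A.1 (B.1 1) + C.1 1 := fun _ _ _ => rfl
  rw [e, J_apply_one hn, map_zero, zero_add]
  by_cases h : n = 0
  · subst h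
    rw [if_pos (by norm_num), if_pos rfl, Int.cast_zero, zero_add]
    rfl
  · rw [if_neg h, if_neg (by omega)]
    rfl

/-- The constant term in the Virasoro relations. -/
def virCocycle (m n : ℤ) : Weyl K :=
  if m + n = 0 then (((m : K) - n) / 16) • (hbar * hbar) else 0

lemma virCocycle_comm (m n : ℤ) (T : Weyl K) : virCocycle m n * T = T * virCocycle m n := by
  rw [virCocycle]
  split_ifs
  · rw [smul_mul_assoc, mul_smul_comm, mul_assoc, hbar_comm T, ← mul_assoc, hbar_comm T,
      mul_assoc]
  · rw [zero_mul, mul_zero]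

lemma virCocycle_apply_one (m n : ℤ) : (virCocycle m n : Weyl K).1 1 =
    if m + n = 0 then (((m : K) - n) / 16) • hbar.1 (hbar.1 1) else 0 := by
  rw [virCocycle]
  split_ifs <;> rfl

/-- The defect of the Virasoro relation on `1`, where the term `vir m (vir n 1)` is already zero. In
this range `m + n = 0` forces `(m, n) = (-1, 1)`, and the value there is `-ℏ²/8`, which explains the
factor `1/16` in `virCocycle`. -/
lemma vir_commutator_apply_one [CharZero K] {m n : ℤ} (hm : -1 ≤ m) (hn : 0 ≤ n) (hmn : m < n) :
    -(vir n : Weyl K).1 ((vir m : Weyl K).1 1) -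
      (((m : K) - n) • hbar.1 ((vir (m + n) : Weyl K).1 1) + (virCocycle m n : Weyl K).1 1)
      = 0 := by
  rw [virCocycle_apply_one]
  rcases hm.eq_or_lt with rfl | hm
  · rw [vir_apply_vir_neg_one_apply_one hn]
    rcases hn.eq_or_lt with rfl | hn1
    · rw [if_neg (by omega), show (-1 + 0 : ℤ) = -1 from rfl, vir_neg_one_apply_one, map_smul,
        show (0 - 1 : ℤ) = -1 from rfl]
      push_cast
      module
    · have h : (J (-1) * J (n - 1) : Weyl K).1 1 = 0 := by
        rw [Weyl.mul_apply, J_apply_one (by omega), map_zero]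
      rw [vir_apply_one (by omega), h, J_mul_J_neg_one_apply_one (by omega)]
      by_cases h : n = 1
      · subst h
        rw [if_pos (by norm_num), if_pos (by norm_num), map_smul, map_zero]
        push_cast
        module
      · rw [if_neg (by omega), if_neg (by omega), map_zero]
        simp
  · rw [vir_apply_one (by omega : 0 ≤ m), vir_apply_one (by omega), if_neg (by omega)]
    simp

/-- The Virasoro relations. -/
theorem vir_commutator [CharZero K] {m n : ℤ} (hm : -1 ≤ m) (hn : -1 ≤ n) :
    (vir m * vir n - vir n * vir m : Weyl K) =
      ((m : K) - n) • (hbar * vir (m + n)) + virCocycle m n := by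
  -- By antisymmetry `m < n` may be assumed, so that `n ≥ 0` and `vir n` kills `1`.
  wlog hmn : m < n generalizing m n
  · rcases (not_lt.1 hmn).eq_or_lt with rfl | h
    · simp [virCocycle]
    · rw [← neg_sub, this hn hm h, add_comm m n, virCocycle, virCocycle, add_comm m n]
      split_ifs <;> module
  rw [← sub_eq_zero]
  refine Weyl.eq_zero_of_commute_x ?_ fun i => ?_
  · have hn0 : 0 ≤ n := by omega
    have e : ∀ A B C D : Weyl K, (A * B - B * A - (((m : K) - n) • (hbar * C) + D)).1 1 =
      A.1 (B.1 1) - B.1 (A.1 1) - (((m : K) - n) • hbar.1 (C.1 1) + D.1 1) := fun _ _ _ _ => rfl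
    rw [e, vir_apply_one hn0, map_zero, zero_sub]
    exact vir_commutator_apply_one hm hn0 hmn
  · obtain ⟨k, rfl⟩ : ∃ k : ℕ, i = k.succPNat := ⟨i.natPred, (PNat.succPNat_natPred i).symm⟩
    rw [x_eq_smul_J, mul_smul_comm, smul_mul_assoc]
    congr 1
    set c := Int.negSucc k
    have h1 := vir_commutator_commutator_J (K := K) m n c
    have h2 := vir_commutator_J (K := K) (m + n) c
    rw [sub_eq_iff_eq_add] at h1 h2
    rw [sub_mul, mul_sub (J c : Weyl K), h1, add_mul (_ • (hbar * vir (m + n))), virCocycle_comm, smul_mul_assoc,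
      mul_assoc hbar (vir (m + n)), h2, mul_add hbar, mul_neg, mul_smul_comm, mul_add (J c : Weyl K),
      mul_smul_comm, ← mul_assoc (J c) hbar, ← hbar_comm (J c), mul_assoc hbar (J c),
      ← mul_assoc hbar hbar]
    module

/-! ### Closed subspaces of the completed Weyl algebra -/

lemma Weyl.tsum_val_mem {ι : Type*} {T : ι → Weyl K} (hs : Summable T)
    {P : Submodule K (Op K)} (hP : IsClosed (P : Set (Op K))) (h : ∀ i, (T i).1 ∈ P) :
    (∑' i, T i : Weyl K).1 ∈ P := by
  refine hP.mem_of_tendsto ((continuous_subtype_val.tendsto _).comp hs.hasSum)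
    (Eventually.of_forall fun s => ?_)
  rw [Function.comp_apply, AddSubmonoidClass.coe_finsetSum]
  exact P.sum_mem fun i _ => h i

/-- The operators that map `f` to a series of degree at least `n`. -/
def Op.applyGeSubmodule (f : Series K) (n : ℕ) : Submodule K (Op K) :=
  (Series.geSubmodule K n).comap (LinearMap.applyₗ f)

lemma Op.isClosed_applyGeSubmodule (f : Series K) (n : ℕ) :
    IsClosed (Op.applyGeSubmodule f n : Set (Op K)) :=
  (Series.isClosed_degGE n).preimage (Op.continuous_apply f)

lemma Op.leSubmodule_mono {m n : ℕ} (h : m ≤ n) : Op.leSubmodule K m ≤ Op.leSubmodule K n :=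
  fun _ hT e f hf k hk => hT e f hf k (by omega)

lemma J_mem_ge (a : ℤ) : (J a : Weyl K).1 ∈ Op.geSubmodule K 1 := by
  rcases a with n | n
  · exact hbarOp_mul_dOp_mem_ge _
  · exact (Op.geSubmodule K 1).smul_mem _ (xOp_mem_ge _)

lemma J_mem_le (a : ℤ) : (J a : Weyl K).1 ∈ Op.leSubmodule K 1 := by
  rcases a with n | n
  · exact hbarOp_mul_dOp_mem_le _
  · exact (Op.leSubmodule K 1).smul_mem _ (xOp_mem_le _)

lemma virTerm_mem_ge [CharZero K] (m a : ℤ) : (virTerm m a : Weyl K).1 ∈ Op.geSubmodule K 2 := by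
  rw [virTerm, normalOrdered_eq]
  exact fun e f hf => J_mem_ge _ _ _ (J_mem_ge _ _ _ hf)

lemma virTerm_mem_le [CharZero K] (m a : ℤ) : (virTerm m a : Weyl K).1 ∈ Op.leSubmodule K 2 := by
  rw [virTerm, normalOrdered_eq]
  exact fun e f hf => J_mem_le _ _ _ (J_mem_le _ _ _ hf)

lemma vir_mem_ge [CharZero K] (m : ℤ) : (vir m : Weyl K).1 ∈ Op.geSubmodule K 2 :=
  (Op.geSubmodule K 2).smul_mem _
    (Weyl.tsum_val_mem (summable_virTerm m) (Op.isClosed_geSubmodule 2) (virTerm_mem_ge m))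

lemma vir_mem_le [CharZero K] (m : ℤ) : (vir m : Weyl K).1 ∈ Op.leSubmodule K 2 :=
  (Op.leSubmodule K 2).smul_mem _
    (Weyl.tsum_val_mem (summable_virTerm m) (Op.isClosed_leSubmodule 2) (virTerm_mem_le m))

theorem exists_forall_degGE_vir [CharZero K] (f : Series K) (n : ℕ) :
    ∃ M : ℤ, ∀ m, M ≤ m → ((vir m : Weyl K).1 f).DegGE n := by
  obtain ⟨M, hM⟩ := exists_forall_degGE_virTerm f n
  -- The two indices add up to `m - 1 ≥ 2M - 1`, so the larger one is at least `M`.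
  refine ⟨2 * M, fun m hm => ?_⟩
  exact (Op.applyGeSubmodule f n).smul_mem _ (Weyl.tsum_val_mem (summable_virTerm m)
    (Op.isClosed_applyGeSubmodule f n) fun a => hM m a (by omega))

/-! ### The operators `H_i` -/

/-- The coefficient of `ℏ` in `H_i`. -/
def twistedConst (N : ℤ) (D : ℕ+ → K) (i : ℕ+) : K :=
  (if (i : ℤ) = 1 - N then 1 / 16 else 0) + if (i : ℤ) ≤ N + 1 then D i else 0

lemma twistedH_eq (N : ℤ) (D : ℕ+ → K) (i : ℕ+) :
    twistedH N D i = hd i + vir (i + N - 1) + twistedConst N D i • hbar := by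
  rw [twistedH, twistedConst, add_smul, ite_smul, ite_smul, zero_smul, add_assoc (_ + _)]
  rfl

lemma hd_eq_J (i : ℕ+) : (hd i : Weyl K) = J ((i : ℤ) - 1) := by
  have h : ((i : ℤ) - 1) = (i.natPred : ℕ) := by
    have := PNat.natPred_add_one i
    omega
  rw [h, J_natCast, PNat.succPNat_natPred]

lemma hd_vir_commutator [CharZero K] (i : ℕ+) (m : ℤ) :
    (vir m * hd i - hd i * vir m : Weyl K) =
      -(((i : K) - 1 / 2) • (hbar * J (m + i - 1))) := by
  rw [hd_eq_J, vir_commutator_J, add_sub_assoc]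
  congr 2
  push_cast
  ring

lemma Weyl.commutator_add_central {Z Z' : Weyl K} (hZ : ∀ T, Z * T = T * Z)
    (hZ' : ∀ T, Z' * T = T * Z') (A A' B B' : Weyl K) :
    (A + B + Z) * (A' + B' + Z') - (A' + B' + Z') * (A + B + Z) =
      (A * A' - A' * A) + (B * B' - B' * B) + (B * A' - A' * B) - (B' * A - A * B') := by
  rw [mul_add _ _ Z', add_mul _ Z', hZ', add_mul _ Z, mul_add _ _ Z, hZ]
  noncomm_ring

theorem twistedH_commutator [CharZero K] {N : ℤ} (hN : -1 ≤ N) (D : ℕ+ → K) (i j k : ℕ+)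
    (hk : (k : ℤ) = i + j + N - 1) :
    twistedH N D i * twistedH N D j - twistedH N D j * twistedH N D i =
      ((i : K) - (j : K)) • (hbar * twistedH N D k) := by
  have hi := i.pos
  have hj := j.pos
  have hcen : ∀ (c : K) (T : Weyl K), (c • hbar) * T = T * (c • hbar) := fun c T => by
    rw [smul_mul_assoc, mul_smul_comm, hbar_comm]
  rw [twistedH_eq, twistedH_eq, twistedH_eq,
    Weyl.commutator_add_central (hcen _) (hcen _), hd_comm, sub_self, zero_add,
    vir_commutator (by omega) (by omega), hd_vir_commutator, hd_vir_commutator, hd_eq_J k,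
    show (i : ℤ) + N - 1 + (j + N - 1) = k + N - 1 by omega,
    show (i : ℤ) + N - 1 + j - 1 = k - 1 by omega,
    show (j : ℤ) + N - 1 + i - 1 = k - 1 by omega, mul_add, mul_add, mul_smul_comm, smul_add,
    smul_add, virCocycle]
  -- The cocycle is supported at `k = 1 - N` and is matched by the `1/16` in `twistedConst`. The
  -- term `D k` requires `k ≤ N + 1`, hence `i = j = 1`, where the factor `i - j` vanishes.
  have hconst : (if (i : ℤ) + N - 1 + (j + N - 1) = 0 then
      ((((i : ℤ) + N - 1 : ℤ) : K) - ((j : ℤ) + N - 1 : ℤ)) / 16 else 0) =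
        ((i : K) - j) * twistedConst N D k := by
    rw [twistedConst]
    by_cases h1 : (k : ℤ) = 1 - N
    · rw [if_pos (by omega), if_pos h1]
      by_cases h2 : (k : ℤ) ≤ N + 1
      · have : i = j := PNat.eq (by omega)
        subst this
        simp
      · rw [if_neg h2]
        push_cast
        ring
    · rw [if_neg (by omega), if_neg h1]
      by_cases h2 : (k : ℤ) ≤ N + 1
      · have : i = j := PNat.eq (by omega)
        subst this
        simp
      · rw [if_neg h2]
        simp
  rw [← ite_zero_smul, hconst]
  push_cast
  module

theorem exists_forall_degGE_twistedH [CharZero K] (N : ℤ) (D : ℕ+ → K) (f : Series K) (n : ℕ) :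
    ∃ M : ℕ, ∀ i : ℕ+, M < i → ((twistedH N D i).1 f).DegGE n := by
  obtain ⟨M, hM⟩ := exists_forall_degGE_hd f n
  obtain ⟨M', hM'⟩ := exists_forall_degGE_vir f n
  refine ⟨M + (M' - N + 1).toNat + (1 - N).toNat + (N + 1).toNat, fun i hi => ?_⟩
  rw [twistedH_eq, twistedConst, if_neg (by omega), if_neg (by omega), add_zero, zero_smul,
    add_zero]
  exact (Series.geSubmodule K n).add_mem (hM i (by omega)) (hM' _ (by omega))

lemma twistedH_mem_le [CharZero K] (N : ℤ) (D : ℕ+ → K) (i : ℕ+) :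
    (twistedH N D i).1 ∈ Op.leSubmodule K 2 := by
  rw [twistedH_eq]
  exact add_mem (add_mem (Op.leSubmodule_mono (by omega) (hbarOp_mul_dOp_mem_le i)) (vir_mem_le _))
    ((Op.leSubmodule K 2).smul_mem _ hbarOp_mem_le)

lemma twistedH_sub_hd_mem_ge [CharZero K] (N : ℤ) (D : ℕ+ → K) (i : ℕ+) :
    (twistedH N D i - hd i).1 ∈ Op.geSubmodule K 2 := by
  rw [twistedH_eq, add_assoc, add_sub_cancel_left]
  exact add_mem (vir_mem_ge _) ((Op.geSubmodule K 2).smul_mem _ hbarOp_mem_ge)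

/-! ### Continuous linear maps on the dual space -/

/-- The coordinate of a functional at a basis vector. -/
def VDual.coord (i : ℕ+) : VDual K →ₗ[K] K := LinearMap.applyₗ (Finsupp.single i 1)

lemma VDual.coord_y [DecidableEq ℕ+] (i j : ℕ+) :
    VDual.coord i (y j : VDual K) = if i = j then 1 else 0 := by
  classical
  refine (Finsupp.single_apply (a := i) (a' := j) (b := (1 : K))).trans ?_
  congr

lemma VDual.apply_eq_sum (u : VDual K) (a : ℕ+ →₀ K) :
    u a = ∑ i ∈ a.support, VDual.coord i u * a i := by
  conv_lhs => rw [← a.sum_single, Finsupp.sum, map_sum]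
  refine Finset.sum_congr rfl fun i _ => ?_
  rw [← mul_one (a i), ← smul_eq_mul (a i) 1, ← Finsupp.smul_single, map_smul, smul_eq_mul,
    smul_eq_mul, mul_one, mul_comm]
  rfl

theorem VDual.tendsto_iff {ι : Type*} {l : Filter ι} {F : ι → VDual K} {u : VDual K} :
    Tendsto F l (@nhds _ dualTopology u) ↔ ∀ a, ∀ᶠ i in l, F i a = u a := by
  rw [dualTopology, @nhds_induced _ _ (@Pi.topologicalSpace _ _ fun _ => ⊥), tendsto_comap_iff,
    @nhds_pi _ _ (fun _ => ⊥), tendsto_pi]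
  refine forall_congr' fun a => ?_
  rw [@nhds_discrete _ ⊥ (@DiscreteTopology.mk _ ⊥ rfl), tendsto_pure]
  rfl

/-- Modulo terms of high degree, the value of `L(u)` at a series depends on finitely many coordinates
of `u`. This implies continuity. -/
def FiniteDependence (L : VDual K →ₗ[K] Weyl K) : Prop :=
  ∀ (f : Series K) (n : ℕ), ∃ M : ℕ, ∀ u, (∀ i : ℕ+, (i : ℕ) ≤ M → VDual.coord i u = 0) →
    ((L u).1 f).DegGE n

theorem FiniteDependence.isContinuous {L : VDual K →ₗ[K] Weyl K} (hL : FiniteDependence L) :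
    IsContinuous L := by
  refine (@continuous_iff_continuousAt _ _ dualTopology _ _).2 fun u => Weyl.tendsto_iff.2
    fun f n => ?_
  obtain ⟨M, hM⟩ := hL f n
  have h := VDual.tendsto_iff.1 (@tendsto_id _ (@nhds _ dualTopology u))
  have hfin : {i : ℕ+ | (i : ℕ) ≤ M}.Finite :=
    (Set.finite_Iic M).preimage PNat.coe_injective.injOn
  have h' := (eventually_all_finite hfin).2 fun i _ => h (Finsupp.single i 1)
  filter_upwards [h'] with v hv
  have := hM (v - u) fun i hi => sub_eq_zero.2 (hv i hi)
  rw [map_sub] at this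
  exact this

lemma FiniteDependence.mulLeft {L : VDual K →ₗ[K] Weyl K} (hL : FiniteDependence L) (T : Weyl K) :
    FiniteDependence (LinearMap.mulLeft K T ∘ₗ L) := by
  intro f n
  obtain ⟨M, hM⟩ := hL f n
  refine ⟨M, fun u hu => ?_⟩
  rw [LinearMap.comp_apply, LinearMap.mulLeft_apply, Weyl.mul_apply]
  exact T.degGE_apply (hM u hu)

lemma FiniteDependence.mulRight {L : VDual K →ₗ[K] Weyl K} (hL : FiniteDependence L) (T : Weyl K) :
    FiniteDependence (LinearMap.mulRight K T ∘ₗ L) := by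
  intro f n
  obtain ⟨M, hM⟩ := hL (T.1 f) n
  refine ⟨M, fun u hu => ?_⟩
  rw [LinearMap.comp_apply, LinearMap.mulRight_apply, Weyl.mul_apply]
  exact hM u hu

lemma FiniteDependence.add {L L' : VDual K →ₗ[K] Weyl K} (hL : FiniteDependence L)
    (hL' : FiniteDependence L') : FiniteDependence (L + L') := by
  intro f n
  obtain ⟨M, hM⟩ := hL f n
  obtain ⟨M', hM'⟩ := hL' f n
  refine ⟨max M M', fun u hu => ?_⟩
  rw [LinearMap.add_apply]
  exact (Series.geSubmodule K n).add_mem (hM u fun i hi => hu i (hi.trans (le_max_left _ _)))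
    (hM' u fun i hi => hu i (hi.trans (le_max_right _ _)))

lemma FiniteDependence.comp {L : VDual K →ₗ[K] Weyl K} (hL : FiniteDependence L)
    {B : VDual K →ₗ[K] VDual K} (hB : ∀ M : ℕ, ∃ M' : ℕ, ∀ u,
      (∀ i : ℕ+, (i : ℕ) ≤ M' → VDual.coord i u = 0) →
        ∀ i : ℕ+, (i : ℕ) ≤ M → VDual.coord i (B u) = 0) : FiniteDependence (L ∘ₗ B) := by
  intro f n
  obtain ⟨M, hM⟩ := hL f n
  obtain ⟨M', hM'⟩ := hB M
  exact ⟨M', fun u hu => hM (B u) (hM' u hu)⟩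

/-- The finite sums `∑ u_i y_i` converge to `u`, as they agree with `u` on any vector once its
support is exhausted. The target is Hausdorff. -/
theorem eq_of_isContinuous {L L' : VDual K →ₗ[K] Weyl K} (hL : IsContinuous L)
    (hL' : IsContinuous L') (h : ∀ i, L (y i) = L' (y i)) : L = L' := by
  classical
  refine LinearMap.ext fun u => ?_
  have hu : Tendsto (fun s : Finset ℕ+ => ∑ i ∈ s, VDual.coord i u • (y i : VDual K)) atTop
      (@nhds _ dualTopology u) := by
    refine VDual.tendsto_iff.2 fun a => ?_
    filter_upwards [eventually_ge_atTop a.support] with s hs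
    rw [VDual.apply_eq_sum u a, LinearMap.sum_apply]
    refine (Finset.sum_subset hs fun i _ hi => ?_).symm
    change VDual.coord i u * a i = 0
    rw [Finsupp.notMem_support_iff.1 hi, mul_zero]
  have h1 := ((@Continuous.tendsto _ _ dualTopology _ _ hL u).comp hu)
  have h2 := ((@Continuous.tendsto _ _ dualTopology _ _ hL' u).comp hu)
  refine tendsto_nhds_unique h1 (h2.congr fun s => ?_)
  simp [h]

/-! ### Involutivity -/

/-- By the Leibniz rule, a left multiple `b A` contributes `[·, b] A + b [·, A]`. The first term is
`ℏ` times an element of the left ideal, because `[·, b]` is divisible by `ℏ` and `A` lies in the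
ideal. -/
theorem involutive_of_isSubalgebraic {L : VDual K →ₗ[K] Weyl K} (hL : IsSubalgebraic L) :
    ∀ S ∈ leftIdeal L, ∀ T ∈ leftIdeal L, ∃ U ∈ leftIdeal L, S * T - T * S = hbar * U := by
  have h1 : ∀ u, ∀ T ∈ leftIdeal L, ∃ U ∈ leftIdeal L, L u * T - T * L u = hbar * U := by
    intro u T hT
    refine Submodule.span_induction ?_ ?_ ?_ ?_ hT
    · rintro _ ⟨v, rfl⟩
      obtain ⟨w, hw⟩ := hL u v
      exact ⟨L w, Ideal.subset_span ⟨w, rfl⟩, hw⟩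
    · exact ⟨0, zero_mem _, by simp⟩
    · rintro A B _ _ ⟨U, hU, h⟩ ⟨U', hU', h'⟩
      exact ⟨U + U', add_mem hU hU', by rw [mul_add hbar, ← h, ← h']; noncomm_ring⟩
    · rintro b A hA ⟨U, hU, h⟩
      obtain ⟨C, hC⟩ := exists_commutator_eq (L u) b
      refine ⟨C * A + b * U, add_mem (Ideal.mul_mem_left _ _ hA) (Ideal.mul_mem_left _ _ hU), ?_⟩
      have e : L u * (b * A) - b * A * L u =
        (L u * b - b * L u) * A + b * (L u * A - A * L u) := by noncomm_ring
      rw [smul_eq_mul, e, h, hC, mul_add hbar, mul_assoc, ← mul_assoc b, ← hbar_comm b, mul_assoc]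
  intro S hS T hT
  refine Submodule.span_induction ?_ ?_ ?_ ?_ hS
  · rintro _ ⟨u, rfl⟩
    exact h1 u T hT
  · exact ⟨0, zero_mem _, by simp⟩
  · rintro A B _ _ ⟨U, hU, h⟩ ⟨U', hU', h'⟩
    exact ⟨U + U', add_mem hU hU', by rw [mul_add hbar, ← h, ← h']; noncomm_ring⟩
  · rintro b A hA ⟨U, hU, h⟩
    obtain ⟨C, hC⟩ := exists_commutator_eq b T
    refine ⟨C * A + b * U, add_mem (Ideal.mul_mem_left _ _ hA) (Ideal.mul_mem_left _ _ hU), ?_⟩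
    have e : b * A * T - T * (b * A) = (b * T - T * b) * A + b * (A * T - T * A) := by noncomm_ring
    rw [smul_eq_mul, e, h, hC, mul_add hbar, mul_assoc, ← mul_assoc b, ← hbar_comm b, mul_assoc]

/-! ### The quantum Airy structure of the twisted boson -/

lemma summable_coord_smul_twistedH [CharZero K] (N : ℤ) (D : ℕ+ → K) (u : VDual K) :
    Summable fun i => VDual.coord i u • twistedH N D i := by
  refine Weyl.summable_of_finite fun f n => ?_
  obtain ⟨M, hM⟩ := exists_forall_degGE_twistedH N D f n
  refine ((Set.finite_Iic M).preimage (f := fun i : ℕ+ => (i : ℕ))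
    PNat.coe_injective.injOn).subset fun i hi => ?_
  by_contra h
  exact hi ((Series.geSubmodule K n).smul_mem _ (hM i (not_le.1 h)))

/-- The continuous linear map with `y_i ↦ H_i`. -/
def twistedMap [CharZero K] (N : ℤ) (D : ℕ+ → K) : VDual K →ₗ[K] Weyl K where
  toFun u := ∑' i, VDual.coord i u • twistedH N D i
  map_add' u v := by
    simp only [map_add, add_smul]
    exact (summable_coord_smul_twistedH N D u).tsum_add (summable_coord_smul_twistedH N D v)
  map_smul' c u := by
    simp only [map_smul, smul_assoc]
    exact (summable_coord_smul_twistedH N D u).tsum_const_smul c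

lemma twistedMap_y [CharZero K] (N : ℤ) (D : ℕ+ → K) (i : ℕ+) :
    twistedMap N D (y i) = twistedH N D i := by
  refine (tsum_eq_single i fun j hj => ?_).trans ?_
  · rw [VDual.coord_y, if_neg hj, zero_smul]
  · rw [VDual.coord_y, if_pos rfl, one_smul]

lemma finiteDependence_twistedMap [CharZero K] (N : ℤ) (D : ℕ+ → K) :
    FiniteDependence (twistedMap N D) := by
  intro f n
  obtain ⟨M, hM⟩ := exists_forall_degGE_twistedH N D f n
  refine ⟨M, fun u hu => Weyl.tsum_val_mem (summable_coord_smul_twistedH N D u)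
    (Op.isClosed_applyGeSubmodule f n) fun i => ?_⟩
  by_cases hi : (i : ℕ) ≤ M
  · rw [hu i hi, zero_smul]
    exact zero_mem _
  · exact (Op.applyGeSubmodule f n).smul_mem _ (hM i (not_le.1 hi))

/-- The coordinates of the bracket on `V^*` that corresponds to the Virasoro relations. -/
def virBracketCoord (N : ℤ) : VDual K →ₗ[K] VDual K →ₗ[K] (ℕ+ → K) :=
  -- For `N ≥ -1` the equation `k = i + j + N - 1` forces `i, j ≤ k + 1`, so finite sums suffice and
  -- no convergence question arises.
  LinearMap.mk₂ K (fun u v k => ∑ i ∈ Finset.Icc 1 (k + 1), ∑ j ∈ Finset.Icc 1 (k + 1),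
      (if (k : ℤ) = i + j + N - 1 then (i : K) - j else 0) * (VDual.coord i u * VDual.coord j v))
    (fun _ _ _ => funext fun _ => by simp [add_mul, mul_add, Finset.sum_add_distrib])
    (fun _ _ _ => funext fun _ => by simp [Finset.mul_sum, mul_left_comm, mul_assoc])
    (fun _ _ _ => funext fun _ => by simp [mul_add, Finset.sum_add_distrib])
    (fun _ _ _ => funext fun _ => by simp [Finset.mul_sum, mul_left_comm])

/-- The bracket on `V^*` that corresponds to the Virasoro relations. -/
def virBracket (N : ℤ) : VDual K →ₗ[K] VDual K →ₗ[K] VDual K :=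
  (virBracketCoord N).compr₂ (Finsupp.llift K K K ℕ+).toLinearMap

lemma coord_virBracket (N : ℤ) (u v : VDual K) (k : ℕ+) :
    VDual.coord k (virBracket N u v) =
      ∑ i ∈ Finset.Icc 1 (k + 1), ∑ j ∈ Finset.Icc 1 (k + 1),
        (if (k : ℤ) = i + j + N - 1 then (i : K) - j else 0) *
          (VDual.coord i u * VDual.coord j v) := by
  change Finsupp.llift K K K ℕ+ (virBracketCoord N u v) (Finsupp.single k 1) = _
  simp [virBracketCoord]

lemma VDual.ext_coord {u v : VDual K} (h : ∀ i, VDual.coord i u = VDual.coord i v) : u = v :=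
  LinearMap.ext fun a => by simp only [VDual.apply_eq_sum, h]

lemma coord_virBracket_y {N : ℤ} (hN : -1 ≤ N) (i j k : ℕ+) :
    VDual.coord k (virBracket N (y i) (y j) : VDual K) =
      if (k : ℤ) = i + j + N - 1 then (i : K) - j else 0 := by
  rw [coord_virBracket]
  have hi := i.pos
  have hj := j.pos
  by_cases h : (k : ℤ) = i + j + N - 1
  · have hi' : i ∈ Finset.Icc 1 (k + 1) := by
      rw [Finset.mem_Icc, ← PNat.coe_le_coe, ← PNat.coe_le_coe, PNat.add_coe, PNat.one_coe]
      omega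
    have hj' : j ∈ Finset.Icc 1 (k + 1) := by
      rw [Finset.mem_Icc, ← PNat.coe_le_coe, ← PNat.coe_le_coe, PNat.add_coe, PNat.one_coe]
      omega
    rw [Finset.sum_eq_single_of_mem i hi', Finset.sum_eq_single_of_mem j hj']
    · simp [VDual.coord_y]
    · intro b _ hb
      simp [VDual.coord_y, hb]
    · intro b _ hb
      simp [VDual.coord_y, hb]
  · rw [if_neg h]
    refine Finset.sum_eq_zero fun a _ => Finset.sum_eq_zero fun b _ => ?_
    rw [VDual.coord_y, VDual.coord_y]
    by_cases ha : a = i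
    · by_cases hb : b = j
      · rw [ha, hb, if_neg h, zero_mul]
      · rw [if_neg hb, mul_zero, mul_zero]
    · rw [if_neg ha, zero_mul, mul_zero]

theorem twistedH_commutator_eq_twistedMap [CharZero K] {N : ℤ} (hN : -1 ≤ N) (D : ℕ+ → K) (i j : ℕ+) :
    twistedH N D i * twistedH N D j - twistedH N D j * twistedH N D i =
      hbar * twistedMap N D (virBracket N (y i) (y j)) := by
  have hi := i.pos
  have hj := j.pos
  by_cases h : 0 < (i : ℤ) + j + N - 1
  · obtain ⟨k, hk⟩ : ∃ k : ℕ+, (k : ℤ) = i + j + N - 1 :=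
      ⟨⟨((i : ℤ) + j + N - 1).toNat, by omega⟩, by rw [PNat.mk_coe]; omega⟩
    have : virBracket N (y i) (y j) = ((i : K) - j) • (y k : VDual K) := by
      refine VDual.ext_coord fun l => ?_
      rw [coord_virBracket_y hN, map_smul, VDual.coord_y, smul_eq_mul, mul_ite, mul_one, mul_zero,
        ← hk]
      simp only [Nat.cast_inj, PNat.coe_inj]
    rw [this, map_smul, twistedMap_y, twistedH_commutator hN D i j k hk, mul_smul_comm]
  -- The index `i + j + N - 1` fails to be positive only for `N = -1`, `i = j = 1`.
  · have hij : i = j := PNat.eq (by omega)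
    have : virBracket N (y i) (y j) = (0 : VDual K) := by
      refine VDual.ext_coord fun l => ?_
      rw [coord_virBracket_y hN, hij, sub_self, ite_self, map_zero]
    rw [this, map_zero, mul_zero, hij, sub_self]

lemma coord_virBracket_eq_zero {N : ℤ} {M : ℕ} {u : VDual K}
    (hu : ∀ i : ℕ+, (i : ℕ) ≤ M + 1 → VDual.coord i u = 0) (v : VDual K) {k : ℕ+}
    (hk : (k : ℕ) ≤ M) :
    VDual.coord k (virBracket N u v) = 0 ∧ VDual.coord k (virBracket N v u) = 0 := by
  have h : ∀ i ∈ Finset.Icc 1 (k + 1), VDual.coord i u = 0 := by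
    intro i hi
    refine hu i ?_
    have := (PNat.coe_le_coe _ _).2 (Finset.mem_Icc.1 hi).2
    rw [PNat.add_coe, PNat.one_coe] at this
    omega
  rw [coord_virBracket, coord_virBracket]
  constructor <;> refine Finset.sum_eq_zero fun i hi => Finset.sum_eq_zero fun j hj => ?_
  · rw [h i hi, zero_mul, mul_zero]
  · rw [h j hj, mul_zero, mul_zero]

/-- Both sides are continuous in each argument separately: coordinates of the bracket up to `M`
involve only coordinates up to `M + 1` of each argument. The relation extends by density from the
`y_i`, first in `u`, then in `v`. -/
theorem twistedMap_commutator [CharZero K] {N : ℤ} (hN : -1 ≤ N) (D : ℕ+ → K) (u v : VDual K) :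
    twistedMap N D u * twistedMap N D v - twistedMap N D v * twistedMap N D u =
      hbar * twistedMap N D (virBracket N u v) := by
  have hL := finiteDependence_twistedMap N D
  have hB : ∀ v, FiniteDependence (twistedMap N D ∘ₗ (virBracket N).flip v) ∧
      FiniteDependence (twistedMap N D ∘ₗ virBracket N v) := by
    intro v
    refine ⟨hL.comp fun M => ⟨M + 1, fun u hu k hk => ?_⟩,
      hL.comp fun M => ⟨M + 1, fun u hu k hk => ?_⟩⟩
    · rw [LinearMap.flip_apply]
      exact (coord_virBracket_eq_zero (N := N) hu v hk).1
    · exact (coord_virBracket_eq_zero (N := N) hu v hk).2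
  have h1 : ∀ i u, twistedMap N D u * twistedMap N D (y i) =
      twistedMap N D (y i) * twistedMap N D u +
        hbar * twistedMap N D (virBracket N u (y i)) := by
    intro i u
    have h := LinearMap.congr_fun (eq_of_isContinuous
      (hL.mulRight (twistedMap N D (y i))).isContinuous
      ((hL.mulLeft (twistedMap N D (y i))).add ((hB (y i)).1.mulLeft hbar)).isContinuous
      fun j => ?_) u
    · simpa only [LinearMap.add_apply, LinearMap.comp_apply, LinearMap.mulRight_apply,
        LinearMap.mulLeft_apply, LinearMap.flip_apply] using h
    · simp only [LinearMap.add_apply, LinearMap.comp_apply, LinearMap.mulRight_apply,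
        LinearMap.mulLeft_apply, LinearMap.flip_apply, twistedMap_y]
      rw [← twistedH_commutator_eq_twistedMap hN D j i, add_sub_cancel]
  have h := LinearMap.congr_fun (eq_of_isContinuous
    (hL.mulLeft (twistedMap N D u)).isContinuous
    ((hL.mulRight (twistedMap N D u)).add ((hB u).2.mulLeft hbar)).isContinuous fun j => ?_) v
  · simp only [LinearMap.add_apply, LinearMap.comp_apply, LinearMap.mulRight_apply,
      LinearMap.mulLeft_apply] at h
    rw [h, add_sub_cancel_left]
  · simp only [LinearMap.add_apply, LinearMap.comp_apply, LinearMap.mulRight_apply,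
      LinearMap.mulLeft_apply]
    exact h1 j u

lemma isSubalgebraic_twistedMap [CharZero K] {N : ℤ} (hN : -1 ≤ N) (D : ℕ+ → K) :
    IsSubalgebraic (twistedMap N D) :=
  fun u v => ⟨virBracket N u v, twistedMap_commutator hN D u v⟩

theorem isQuantumAiryStructure_twistedMap [CharZero K] {N : ℤ} (hN : -1 ≤ N) (D : ℕ+ → K) :
    IsQuantumAiryStructure (twistedMap N D) where
  continuous := (finiteDependence_twistedMap N D).isContinuous
  involutive := involutive_of_isSubalgebraic (isSubalgebraic_twistedMap hN D)
  linear_term i := by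
    rw [twistedMap_y]
    exact twistedH_sub_hd_mem_ge N D i

/-! ### Action on monomials, and the exact order of the operators -/

lemma hbar_apply_mon (m : Option ℕ+ →₀ ℕ) :
    (hbar : Weyl K).1 (Series.mon K m) = Series.mon K (m + Finsupp.single none 1) :=
  (Series.mon_add_single m none).symm

lemma x_apply_mon (i : ℕ+) (m : Option ℕ+ →₀ ℕ) :
    (x i : Weyl K).1 (Series.mon K m) = Series.mon K (m + Finsupp.single (some i) 1) :=
  (Series.mon_add_single m (some i)).symm

lemma J_negSucc_apply_one (n : ℕ) : (J (Int.negSucc n) : Weyl K).1 1 =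
    ((n : K) + 1 / 2) • Series.mon K (Finsupp.single (some n.succPNat) 1) := by
  rw [← zero_add (Finsupp.single (some n.succPNat) 1), ← x_apply_mon, Series.mon_zero, J_negSucc]
  rfl

lemma degLE_mon (m : Option ℕ+ →₀ ℕ) : (Series.mon K m).DegLE (mdeg m) := by
  classical
  intro m' hm'
  refine (Series.coeff_mon (K := K) m' m).trans (if_neg ?_)
  rintro rfl
  exact lt_irrefl _ hm'

/-- Exhibits a genuinely quadratic term: for `p = i + N - 1`, the operator `vir p` sends `x^{p+1}`
to a nonzero multiple of `ℏ x^1`, which has degree three. -/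
lemma twistedH_apply_x [CharZero K] {N : ℤ} (D : ℕ+ → K) (i : ℕ+) {p : ℕ}
    (hp : (p : ℤ) = i + N - 1) :
    (twistedH N D i).1 ((J (Int.negSucc p)).1 1) =
      (if i = p.succPNat then ((p : K) + 1 / 2) • Series.mon K (Finsupp.single none 1) else 0) +
      (((p : K) + 1 / 2) * (1 / 2)) •
        Series.mon K (Finsupp.single (some 1) 1 + Finsupp.single none 1) +
      (twistedConst N D i * ((p : K) + 1 / 2)) •
        Series.mon K (Finsupp.single (some p.succPNat) 1 + Finsupp.single none 1) := by
  have e : ∀ A B : Weyl K, ∀ c : K, (A + B + c • hbar).1 ((J (Int.negSucc p)).1 1) =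
    (A * J (Int.negSucc p)).1 1 + (B * J (Int.negSucc p)).1 1 +
      c • hbar.1 ((J (Int.negSucc p)).1 1) := fun _ _ _ => rfl
  rw [twistedH_eq, e]
  congr 1
  · congr 1
    · rw [J_negSucc, mul_smul_comm, hd_mul_x]
      have e' : ∀ (A B C : Weyl K) (c : K), (c • (A * B + C)).1 1 =
        c • (A.1 (B.1 1) + C.1 1) := fun _ _ _ _ => rfl
      rw [e', hd_apply_one, map_zero, zero_add]
      split_ifs
      · rw [← zero_add (Finsupp.single none 1), ← hbar_apply_mon, Series.mon_zero]
      · exact smul_zero _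
    · have h := vir_commutator_J (K := K) (i + N - 1) (Int.negSucc p)
      rw [sub_eq_iff_eq_add, show (i : ℤ) + N - 1 + Int.negSucc p = Int.negSucc 0 by omega] at h
      rw [h]
      have e' : ∀ (A B C D : Weyl K) (c : K), (-(c • (A * B)) + C * D).1 1 =
        -(c • A.1 (B.1 1)) + C.1 (D.1 1) := fun _ _ _ _ _ => rfl
      rw [e', vir_apply_one (by omega), map_zero, add_zero, J_negSucc_apply_one, map_smul,
        hbar_apply_mon, smul_smul, ← neg_smul]
      congr 1
      push_cast [Int.cast_negSucc]
      ring
  · rw [J_negSucc_apply_one, map_smul, hbar_apply_mon, smul_smul]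

theorem isQuadratic_twistedMap [CharZero K] {N : ℤ} (hN : -1 ≤ N) (D : ℕ+ → K) :
    IsQuadratic (twistedMap N D) := by
  classical
  refine ⟨fun u => ?_, fun h => ?_⟩
  · exact Weyl.tsum_val_mem (summable_coord_smul_twistedH N D u) (Op.isClosed_leSubmodule 2)
      fun i => (Op.leSubmodule K 2).smul_mem _ (twistedH_mem_le N D i)
  -- The choice `i = 3` gives `p = N + 2 ≥ 1`, so that `ℏ x^1` cannot cancel against the term `ℏ
  -- x^{p+1}` coming from the constant.
  · obtain ⟨p, hp⟩ : ∃ p : ℕ, (p : ℤ) = (3 : ℕ+) + N - 1 :=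
      ⟨(N + 2).toNat, by rw [PNat.val_ofNat]; omega⟩
    have hp0 : p ≠ 0 := by rw [PNat.val_ofNat] at hp; omega
    have h1 : Series.DegLE 1 ((J (Int.negSucc p) : Weyl K).1 1) := by
      have := J_mem_le (K := K) (Int.negSucc p) 0 1 fun m hm => degLE_mon 0 m (by simpa [mdeg] using hm)
      exact this
    have h2 := h (y 3) 1 _ h1
    rw [twistedMap_y, twistedH_apply_x D 3 hp] at h2
    have h3 := Series.degLE_iff.1 h2 (Finsupp.single (some 1) 1 + Finsupp.single none 1)
      (by rw [mdeg_add, mdeg_single, mdeg_single]; exact Nat.lt_succ_self 2)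
    have hne : (Finsupp.single (some 1) 1 + Finsupp.single none 1 : Option ℕ+ →₀ ℕ) ≠
        Finsupp.single (some p.succPNat) 1 + Finsupp.single none 1 := by
      intro h
      have h' : (1 : ℕ+) = p.succPNat := by
        simpa [Finsupp.single_left_inj] using add_right_cancel h
      exact hp0 (by simpa using congrArg PNat.val h'.symm)
    have hne' : (Finsupp.single (some 1) 1 + Finsupp.single none 1 : Option ℕ+ →₀ ℕ) ≠
        Finsupp.single none 1 := by
      intro h
      simpa using DFunLike.congr_fun h (some 1)
    have h0 : Series.coeff (Finsupp.single (some 1) 1 + Finsupp.single none 1)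
        (if (3 : ℕ+) = p.succPNat then ((p : K) + 1 / 2) • Series.mon K (Finsupp.single none 1)
          else 0) = 0 := by
      split_ifs
      · rw [map_smul, Series.coeff_mon, if_neg hne', smul_zero]
      · exact map_zero _
    rw [map_add, map_add, h0, map_smul, map_smul, Series.coeff_mon, Series.coeff_mon, if_pos rfl,
      if_neg hne] at h3
    have := natCast_add_half_ne_zero (K := K) p
    simp at h3
    simp_all

/-! ### The quadratic parts as sums over pairs of variables -/

/-- Transfers sums over modes in `ℤ` to sums over `ℕ × ℕ` through a common index set that covers
both supports. -/
lemma hasSum_iff_of_injective {S α β M : Type*} [AddCommMonoid M] [TopologicalSpace M]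
    {i : S → α} {j : S → β} (hi : Function.Injective i) (hj : Function.Injective j)
    {f : α → M} {g : β → M} (hfg : ∀ s, f (i s) = g (j s)) (hf : ∀ a ∉ Set.range i, f a = 0)
    (hg : ∀ b ∉ Set.range j, g b = 0) {a : M} : HasSum f a ↔ HasSum g a := by
  rw [← hi.hasSum_iff hf, ← hj.hasSum_iff hg, show f ∘ i = g ∘ j from funext hfg]

theorem summable_xd (g : ℕ × ℕ → K) (m : ℤ) :
    Summable fun p : ℕ × ℕ => if (p.2 : ℤ) = p.1 + m then
      g p • (x p.1.succPNat * hd p.2.succPNat : Weyl K) else 0 := by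
  refine Weyl.summable_of_finite fun f n => ?_
  obtain ⟨M, hM⟩ := exists_forall_degGE_hd f n
  refine ((Set.finite_Iio (M + m.natAbs)).prod (Set.finite_Iio M)).subset fun p hp => ?_
  by_contra h
  refine hp ?_
  by_cases hpm : (p.2 : ℤ) = p.1 + m
  · rw [if_pos hpm]
    have : M ≤ p.2 := by
      by_contra h'
      exact h ⟨Set.mem_Iio.2 (by omega), Set.mem_Iio.2 (by omega)⟩
    refine (Series.geSubmodule K n).smul_mem _ (Weyl.degGE_apply (x p.1.succPNat) (hM _ ?_))
    rw [Nat.succPNat_coe]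
    omega
  · rw [if_neg hpm]
    exact (Series.geSubmodule K n).zero_mem

theorem summable_dd (g : ℕ × ℕ → Weyl K) (m : ℤ) :
    Summable fun p : ℕ × ℕ => if (p.1 : ℤ) + p.2 = m then g p else 0 := by
  refine summable_of_hasFiniteSupport
    (((Set.finite_Iic m.natAbs).prod (Set.finite_Iic m.natAbs)).subset fun p hp => ?_)
  have : (p.1 : ℤ) + p.2 = m := by
    by_contra h
    exact hp (if_neg h)
  exact ⟨Set.mem_Iic.2 (by omega), Set.mem_Iic.2 (by omega)⟩

/-- The terms of `(ℏ/2) ∑_r :b_r b_{m-r}:` with one creation and one annihilation operator. -/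
def virXD (m : ℤ) : Weyl K :=
  ∑' p : ℕ × ℕ, if (p.2 : ℤ) = p.1 + m then
    ((p.1 : K) + 1 / 2) • (x p.1.succPNat * hd p.2.succPNat) else 0

/-- Twice the terms of `(ℏ/2) ∑_r :b_r b_{m-r}:` with two annihilation operators. -/
def virDD (m : ℤ) : Weyl K :=
  ∑' p : ℕ × ℕ, if (p.1 : ℤ) + p.2 = m - 1 then hd p.1.succPNat * hd p.2.succPNat else 0

lemma hasSum_virXD (m : ℤ) : HasSum (fun p : ℕ × ℕ => if (p.2 : ℤ) = p.1 + m then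
    ((p.1 : K) + 1 / 2) • (x p.1.succPNat * hd p.2.succPNat : Weyl K) else 0) (virXD m) :=
  (summable_xd (fun p => (p.1 : K) + 1 / 2) m).hasSum

lemma hasSum_virDD (m : ℤ) : HasSum (fun p : ℕ × ℕ => if (p.1 : ℤ) + p.2 = m - 1 then
    (hd p.1.succPNat * hd p.2.succPNat : Weyl K) else 0) (virDD m) :=
  (summable_dd (fun p => hd p.1.succPNat * hd p.2.succPNat) (m - 1)).hasSum

lemma hasSum_J_neg_J (m : ℤ) : HasSum (fun a : ℤ => if a < 0 ∧ 0 ≤ m - 1 - a then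
    (J a * J (m - 1 - a) : Weyl K) else 0) (virXD m) := by
  refine (hasSum_iff_of_injective (S := {a : ℤ // a < 0 ∧ 0 ≤ m - 1 - a})
    (i := Subtype.val) (j := fun a => ((-1 - a.1).toNat, (m - 1 - a.1).toNat))
    Subtype.val_injective ?_ ?_ ?_ ?_).2 (hasSum_virXD m)
  · rintro ⟨a, ha⟩ ⟨b, hb⟩ h
    simp only [Prod.mk.injEq] at h
    exact Subtype.ext (by dsimp only; omega)
  · rintro ⟨a, ha⟩
    obtain ⟨p, rfl⟩ : ∃ p : ℕ, a = Int.negSucc p := ⟨(-1 - a).toNat, by omega⟩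
    obtain ⟨q, hq⟩ : ∃ q : ℕ, m - 1 - Int.negSucc p = q := ⟨(m - 1 - Int.negSucc p).toNat, by omega⟩
    rw [if_pos ha]
    dsimp only
    have hp : (-1 - Int.negSucc p).toNat = p := by omega
    rw [if_pos (by omega), hp, hq, Int.toNat_natCast, J_negSucc, J_natCast, smul_mul_assoc]
  · intro a ha
    exact if_neg fun h => ha ⟨⟨a, h⟩, rfl⟩
  · rintro ⟨p, q⟩ h
    refine if_neg fun h' => h ⟨⟨-1 - p, by dsimp only at h'; omega⟩, ?_⟩
    dsimp only at h' ⊢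
    rw [Prod.mk.injEq]
    omega

lemma hasSum_J_pos_J (m : ℤ) : HasSum (fun a : ℤ => if 0 ≤ a ∧ 0 ≤ m - 1 - a then
    (J a * J (m - 1 - a) : Weyl K) else 0) (virDD m) := by
  refine (hasSum_iff_of_injective (S := {a : ℤ // 0 ≤ a ∧ 0 ≤ m - 1 - a})
    (i := Subtype.val) (j := fun a => (a.1.toNat, (m - 1 - a.1).toNat))
    Subtype.val_injective ?_ ?_ ?_ ?_).2 (hasSum_virDD m)
  · rintro ⟨a, ha⟩ ⟨b, hb⟩ h
    simp only [Prod.mk.injEq] at h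
    exact Subtype.ext (by dsimp only; omega)
  · rintro ⟨a, ha⟩
    obtain ⟨p, rfl⟩ : ∃ p : ℕ, a = p := ⟨a.toNat, by omega⟩
    obtain ⟨q, hq⟩ : ∃ q : ℕ, m - 1 - p = q := ⟨(m - 1 - p).toNat, by omega⟩
    rw [if_pos ha]
    dsimp only
    rw [if_pos (by omega), hq, Int.toNat_natCast, Int.toNat_natCast, J_natCast, J_natCast]
  · intro a ha
    exact if_neg fun h => ha ⟨⟨a, h⟩, rfl⟩
  · rintro ⟨p, q⟩ h
    refine if_neg fun h' => h ⟨⟨p, by dsimp only at h'; omega⟩, ?_⟩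
    dsimp only at h' ⊢
    rw [Prod.mk.injEq]
    omega

/-- The index `a` is split by the signs of `a` and `m - 1 - a`. The two mixed ranges are exchanged
by `a ↦ m - 1 - a` and give equal sums, cancelling the `1/2`. Both indices are negative only for `m
= a = -1`, where `J (-1)² = (x^1)²/4`. -/
theorem vir_eq [CharZero K] {m : ℤ} (hm : -1 ≤ m) :
    (vir m : Weyl K) = virXD m + (1 / 2 : K) • virDD m +
      (if m = -1 then (1 / 8 : K) • (x 1 * x 1) else 0) := by
  have h1 := hasSum_J_neg_J (K := K) m
  have h2 := (Equiv.subLeft (m - 1)).hasSum_iff.2 h1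
  have h3 := hasSum_J_pos_J (K := K) m
  have h4 := hasSum_ite_eq (-1 : ℤ)
    (if m = -1 then (1 / 4 : K) • (x 1 * x 1 : Weyl K) else 0)
  have h := ((h1.add h2).add h3).add h4
  have hsum : HasSum (fun a : ℤ => (virTerm m a : Weyl K)) (virXD m + virXD m + virDD m +
      if m = -1 then (1 / 4 : K) • (x 1 * x 1 : Weyl K) else 0) := by
    refine h.congr_fun fun a => ?_
    simp only [Function.comp_apply, Equiv.subLeft_apply, sub_sub_cancel]
    rw [virTerm, normalOrdered]
    by_cases ha : 0 ≤ a
    · by_cases hb : 0 ≤ m - 1 - a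
      · rw [if_neg (by omega), if_neg (by omega), if_neg (by omega), if_pos ⟨ha, hb⟩,
          if_neg (by omega), zero_add, zero_add, add_zero]
      · rw [if_pos (by omega), if_neg (by omega), if_pos (by omega), if_neg (by omega),
          if_neg (by omega), zero_add, add_zero, add_zero]
    · by_cases hb : 0 ≤ m - 1 - a
      · rw [if_neg (by omega), if_pos (by omega), if_neg (by omega), if_neg (by omega), add_zero,
          add_zero]
        by_cases h1 : a = -1
        · rw [if_pos h1, if_neg (by omega), add_zero]
        · rw [if_neg h1, add_zero]
      · have h1 : a = -1 := by omega
        have h2 : m = -1 := by omega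
        subst h1 h2
        rw [if_neg (by omega), if_neg (by omega), if_neg (by omega), if_neg (by omega),
          if_pos rfl, if_pos rfl, zero_add, zero_add, zero_add]
        change (J (Int.negSucc 0) * J (Int.negSucc 0) : Weyl K) = _
        rw [J_negSucc, smul_mul_smul_comm]
        congr 1
        norm_num
  rw [vir, hsum.tsum_eq]
  split_ifs <;> module

/-! ### Residues on the curves `ω_{0,1} = -z^{2s} dz` -/

lemma zpow'_mul (m n : ℤ) : (zpow' m * zpow' n : LaurentSeries K) = zpow' (m + n) := by
  rw [zpow', zpow', HahnSeries.single_mul_single, one_mul, zpow']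

lemma zpow'_ne_zero (m : ℤ) : (zpow' m : LaurentSeries K) ≠ 0 :=
  HahnSeries.single_ne_zero one_ne_zero

lemma smul_zpow' (c : K) (n : ℤ) : c • (zpow' n : LaurentSeries K) = HahnSeries.single n c := by
  ext m
  rw [HahnSeries.coeff_smul, zpow', HahnSeries.coeff_single, HahnSeries.coeff_single, smul_eq_mul,
    mul_ite, mul_one, mul_zero]

lemma residue_single (c : K) (n : ℤ) : residue (HahnSeries.single n c) = if n = -1 then c else 0 := by
  rw [residue, HahnSeries.coeff_single]
  simp only [eq_comm]

lemma pullback_neg_zpow' (s : ℕ) : pullback (-zpow' (2 * s) : LaurentSeries K) = zpow' (2 * s) := by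
  ext n
  change -((-1) ^ n * (-(zpow' (2 * s) : LaurentSeries K)).coeff n) = _
  rw [HahnSeries.coeff_neg, mul_neg, neg_neg, zpow', HahnSeries.coeff_single]
  split_ifs with h
  · rw [h, (even_two_mul (s : ℤ)).neg_one_zpow, one_mul]
  · rw [mul_zero]

lemma theta_neg_zpow' [CharZero K] (s : ℕ) :
    theta (-zpow' (2 * s) : LaurentSeries K) = zpow' (-(2 * s)) := by
  have h2 : (2 : LaurentSeries K) ≠ 0 := by
    have : CharZero (LaurentSeries K) :=
      charZero_of_injective_algebraMap (algebraMap K (LaurentSeries K)).injective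
    exact two_ne_zero
  have h : (-zpow' (2 * s) - pullback (-zpow' (2 * s)) : LaurentSeries K) =
      -2 * zpow' (2 * s) := by
    rw [pullback_neg_zpow']
    ring
  rw [theta, h, div_eq_iff (mul_ne_zero (neg_ne_zero.2 h2) (zpow'_ne_zero _)), mul_left_comm,
    zpow'_mul, neg_add_cancel]
  exact (mul_one _).symm

lemma two_mul_add_one_ne_zero [CharZero K] (k : ℕ) : (2 * k + 1 : K) ≠ 0 := by
  exact_mod_cast Nat.succ_ne_zero (2 * k)

lemma dxiStar_eq [CharZero K] (k : ℕ) : (dxiStar k : LaurentSeries K) = zpow' (2 * k) := by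
  rw [dxiStar, xiStar, map_smul, LaurentSeries.derivative_apply, zpow',
    show (2 * k + 1 : ℤ) = 2 * k + (1 : ℕ) by simp, LaurentSeries.hasseDeriv_single_add]
  ext n
  rw [HahnSeries.coeff_smul, HahnSeries.coeff_single, zpow', HahnSeries.coeff_single]
  split_ifs
  · have := two_mul_add_one_ne_zero (K := K) k
    simp
    field_simp
  · exact smul_zero _

/-- As in the next three lemmas, the form is a monomial in `z`, and the condition says that its
exponent is `-1`. -/
lemma trA_eq [CharZero K] (s k l m : ℕ) : trA (-zpow' (2 * s) : LaurentSeries K) k l m =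
    if k + l + m + 1 = s then (2 * k + 1 : K)⁻¹ else 0 := by
  rw [trA, theta_neg_zpow', dxiStar_eq, dxiStar_eq, xiStar, smul_zpow', zpow', zpow',
    zpow']
  simp only [HahnSeries.single_mul_single, residue_single, mul_one]
  exact if_congr (by omega) rfl rfl

lemma trB_eq [CharZero K] (s k l m : ℕ) : trB (-zpow' (2 * s) : LaurentSeries K) k l m =
    if (m : ℤ) = l + ((k : ℤ) - s) then (2 * k + 1 : K)⁻¹ * (2 * m + 1) else 0 := by
  rw [trB, theta_neg_zpow', dxiStar_eq, xiStar, xi, smul_zpow', smul_zpow', zpow',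
    zpow']
  simp only [HahnSeries.single_mul_single, residue_single, mul_one]
  exact if_congr (by omega) rfl rfl

lemma trC_eq [CharZero K] (s k l m : ℕ) : trC (-zpow' (2 * s) : LaurentSeries K) k l m =
    if (l : ℤ) + m = (k : ℤ) - s - 1 then (2 * k + 1 : K)⁻¹ * (2 * l + 1) * (2 * m + 1) else 0 := by
  rw [trC, theta_neg_zpow', xiStar, xi, xi, smul_zpow', smul_zpow', smul_zpow',
    zpow']
  simp only [HahnSeries.single_mul_single, residue_single, mul_one]
  exact if_congr (by omega) (by ring) rfl

lemma trD_eq [CharZero K] (s k : ℕ) : trD (-zpow' (2 * s) : LaurentSeries K) k =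
    if k = s then 1 / 8 * (2 * k + 1 : K)⁻¹ else 0 := by
  rw [trD, theta_neg_zpow', xiStar, smul_zpow', smul_zpow',
    zpow']
  simp only [HahnSeries.single_mul_single, residue_single, mul_one, mul_ite, mul_zero]
  exact if_congr (by omega) (by ring) rfl

/-! ### The operators `H_i` in rescaled variables -/

/-- Here `N = -s` with `s ≤ 1`. A constant `D (k+1)` could enter only for `s = k = 0`, which is why
`D 1 = 0` is assumed in that case. -/
lemma twistedH_succPNat [CharZero K] {s : ℕ} (hs : s ≤ 1) {D : ℕ+ → K} (hD : s = 0 → D 1 = 0)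
    (k : ℕ) : twistedH (-s) D k.succPNat = hd k.succPNat + virXD ((k : ℤ) - s) +
      (1 / 2 : K) • virDD ((k : ℤ) - s) +
      (if (k : ℤ) - s = -1 then (1 / 8 : K) • (x 1 * x 1) else 0) +
      if (k : ℤ) - s = 0 then (1 / 16 : K) • hbar else 0 := by
  rw [twistedH_eq, Nat.succPNat_coe, show ((k.succ : ℕ) : ℤ) + -s - 1 = k - s by push_cast; ring,
    vir_eq (by omega), twistedConst, Nat.succPNat_coe]
  have h : (if ((k.succ : ℕ) : ℤ) ≤ -s + 1 then D k.succPNat else 0) = 0 := by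
    split_ifs with h
    · obtain rfl : k = 0 := by push_cast at h; omega
      exact hD (by push_cast at h; omega)
    · rfl
  rw [h, add_zero, ite_smul, zero_smul, if_congr (show ((k.succ : ℕ) : ℤ) = 1 - -s ↔
    (k : ℤ) - s = 0 by push_cast; omega) rfl rfl]
  simp only [add_assoc]

theorem exists_twistedH_eq_trOperator [CharZero K] {s : ℕ} (hs : s ≤ 1) {D : ℕ+ → K}
    (hD : s = 0 → D 1 = 0) {μ : K} (hμ : μ ^ (2 * s + 1) = 1 / 2) :
    ∃ c r : ℕ → K, (∀ k, c k ≠ 0) ∧ (∀ k, r k ≠ 0) ∧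
      ∀ k : ℕ, twistedH (-s) D k.succPNat = r k • trOperator (-zpow' (2 * s)) c k := by
  have hμ0 : μ ≠ 0 := by
    rintro rfl
    rw [zero_pow (by omega)] at hμ
    norm_num at hμ
  have h21 := two_mul_add_one_ne_zero (K := K)
  -- Put `a_k = -2 c_k / (2k+1)`. The linear term forces the prefactor to be `c_k` itself, the `B`
  -- terms require `a_k a_l = a_{k+l-s}`, and the `C` terms require `a_l a_m = 2 a_k` for `l + m = k
  -- - s - 1`. This is solved by `a_k = μ^(k-s)` with `μ^(2s+1) = 1/2`, which also matches `A` and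
  -- the constant.
  let c : ℕ → K := fun k => -(1 / 2) * (2 * k + 1) * μ ^ ((k : ℤ) - s)
  have hc : ∀ k, c k ≠ 0 := fun k =>
    mul_ne_zero (mul_ne_zero (by norm_num) (h21 k)) (zpow_ne_zero _ hμ0)
  refine ⟨c, c, hc, hc, fun k => ?_⟩
  have hB : HasSum (fun p : ℕ × ℕ => trB (-zpow' (2 * s) : LaurentSeries K) k p.1 p.2 •
      (scaledX c p.1 * scaledD c p.2)) (-(c k)⁻¹ • virXD ((k : ℤ) - s)) := by
    refine ((hasSum_virXD ((k : ℤ) - s)).const_smul (-(c k)⁻¹)).congr_fun fun p => ?_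
    rw [trB_eq]
    split_ifs with h
    · rw [scaledX, scaledD, smul_mul_smul_comm, smul_smul, smul_smul]
      congr 1
      have h1 : μ ^ ((p.2 : ℤ) - s) = μ ^ ((p.1 : ℤ) - s) * μ ^ ((k : ℤ) - s) := by
        rw [← zpow_add₀ hμ0]
        congr 1
        omega
      simp only [c]
      rw [h1]
      have := h21 k
      have := h21 p.2
      have := zpow_ne_zero ((k : ℤ) - s) hμ0
      have := zpow_ne_zero ((p.1 : ℤ) - s) hμ0
      field_simp
    · rw [zero_smul, smul_zero]
  have hC : HasSum (fun p : ℕ × ℕ => trC (-zpow' (2 * s) : LaurentSeries K) k p.1 p.2 •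
      (scaledD c p.1 * scaledD c p.2)) (-(c k)⁻¹ • virDD ((k : ℤ) - s)) := by
    refine ((hasSum_virDD ((k : ℤ) - s)).const_smul (-(c k)⁻¹)).congr_fun fun p => ?_
    rw [trC_eq]
    split_ifs with h
    · rw [scaledD, scaledD, smul_mul_smul_comm, smul_smul]
      congr 1
      have h1 : μ ^ ((p.1 : ℤ) - s) * μ ^ ((p.2 : ℤ) - s) * μ ^ (2 * s + 1) =
          μ ^ ((k : ℤ) - s) := by
        rw [← zpow_natCast, ← zpow_add₀ hμ0, ← zpow_add₀ hμ0]
        congr 1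
        push_cast
        omega
      simp only [c]
      rw [← h1, hμ]
      have := h21 k
      have := h21 p.1
      have := h21 p.2
      have := zpow_ne_zero ((p.1 : ℤ) - s) hμ0
      have := zpow_ne_zero ((p.2 : ℤ) - s) hμ0
      field_simp
    · rw [zero_smul, smul_zero]
  have hA : HasSum (fun p : ℕ × ℕ => trA (-zpow' (2 * s) : LaurentSeries K) k p.1 p.2 •
      (scaledX c p.1 * scaledX c p.2)) (-(c k)⁻¹ •
        if (k : ℤ) - s = -1 then (1 / 4 : K) • (x 1 * x 1 : Weyl K) else 0) := by
    refine ((hasSum_ite_eq ((0 : ℕ), (0 : ℕ)) (if (k : ℤ) - s = -1 then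
      (1 / 4 : K) • (x 1 * x 1 : Weyl K) else 0)).const_smul (-(c k)⁻¹)).congr_fun fun p => ?_
    rw [trA_eq]
    by_cases hp : p = (0, 0)
    · subst hp
      rw [if_pos rfl]
      by_cases h : (k : ℤ) - s = -1
      · rw [if_pos (by omega), if_pos h, scaledX, smul_mul_smul_comm, smul_smul, smul_smul]
        congr 1
        obtain rfl : s = 1 := by omega
        obtain rfl : k = 0 := by omega
        simp only [c]
        norm_num at hμ ⊢
        field_simp
        linear_combination (-8) * hμ
      · rw [if_neg (by omega), if_neg h, zero_smul, smul_zero]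
    · rw [if_neg hp, if_neg, zero_smul, smul_zero]
      intro h
      exact hp (Prod.ext (by dsimp only; omega) (by dsimp only; omega))
  have hDk : -(c k * trD (-zpow' (2 * s) : LaurentSeries K) k) = if (k : ℤ) - s = 0 then 1 / 16 else 0 := by
    rw [trD_eq]
    by_cases h : k = s
    · rw [if_pos h, if_pos (by omega)]
      simp only [c]
      rw [h, sub_self, zpow_zero]
      have := h21 s
      field_simp
      norm_num
    · rw [if_neg h, if_neg (by omega), mul_zero, neg_zero]
  have hA8 : (if (k : ℤ) - s = -1 then (1 / 8 : K) • (x 1 * x 1 : Weyl K) else 0) =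
      (1 / 2 : K) • if (k : ℤ) - s = -1 then (1 / 4 : K) • (x 1 * x 1 : Weyl K) else 0 := by
    split_ifs <;> module
  have hDh : (if (k : ℤ) - s = 0 then (1 / 16 : K) • (hbar : Weyl K) else 0) =
      -(c k * trD (-zpow' (2 * s) : LaurentSeries K) k) • hbar := by
    rw [hDk, ite_smul, zero_smul]
  rw [twistedH_succPNat hs hD, trOperator, hA.tsum_eq, hB.tsum_eq, hC.tsum_eq, scaledD, hA8, hDh]
  have := hc k
  match_scalars <;> field_simp

/-! ### Double factorials and the Virasoro operators of the KdV tau functions -/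

lemma doubleFactorial_two_mul_add_one (l : ℕ) :
    Nat.doubleFactorial (2 * l + 1) = (2 * l + 1) * Nat.doubleFactorial (2 * l - 1) := by
  rcases l with _ | l
  · rfl
  · rw [show 2 * (l + 1) + 1 = 2 * l + 1 + 2 by ring, Nat.doubleFactorial_add_two,
      show 2 * (l + 1) - 1 = 2 * l + 1 by omega]

lemma doubleFactorial_cast_ne_zero [CharZero K] (n : ℕ) : (Nat.doubleFactorial n : K) ≠ 0 :=
  Nat.cast_ne_zero.2 (Nat.doubleFactorial_pos n).ne'

theorem exists_twistedH_eq_kdvVirasoro [CharZero K] {s : ℕ} (hs : s ≤ 1) {D : ℕ+ → K}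
    (hD : s = 0 → D 1 = 0) {μ : K} (hμ : μ ^ (2 * s + 1) = 1 / 2) :
    ∃ c r : ℕ → K, (∀ k, c k ≠ 0) ∧ (∀ k, r k ≠ 0) ∧
      ∀ k : ℕ, twistedH (-s) D k.succPNat = r k • kdvVirasoro s c ((k : ℤ) - s) := by
  have hμ0 : μ ≠ 0 := by
    rintro rfl
    rw [zero_pow (by omega)] at hμ
    norm_num at hμ
  have hF : ∀ n, (Nat.doubleFactorial n : K) ≠ 0 := doubleFactorial_cast_ne_zero
  -- The same solution as for topological recursion, with `(2k+1)!!` in place of `2k+1`. The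
  -- prefactor `r` is then forced by the linear term, and `r s = 1` preserves the constant `ℏ/16`.
  let c : ℕ → K := fun k => -(1 / 2) * Nat.doubleFactorial (2 * k + 1) * μ ^ ((k : ℤ) - s)
  let r : ℕ → K := fun k => (1 / 2) * μ ^ ((k : ℤ) - s) * 2 ^ ((k : ℤ) - s + 1)
  have hc : ∀ k, c k ≠ 0 := fun k =>
    mul_ne_zero (mul_ne_zero (by norm_num) (hF _)) (zpow_ne_zero _ hμ0)
  have hr : ∀ k, r k ≠ 0 := fun k =>
    mul_ne_zero (mul_ne_zero (by norm_num) (zpow_ne_zero _ hμ0)) (zpow_ne_zero _ two_ne_zero)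
  refine ⟨c, r, hc, hr, fun k => ?_⟩
  have hk2 : (2 : K) ^ ((k : ℤ) - s + 1) ≠ 0 := zpow_ne_zero _ two_ne_zero
  have hkμ := zpow_ne_zero ((k : ℤ) - s) hμ0
  have hXD : HasSum (fun p : ℕ × ℕ => if (p.2 : ℤ) = p.1 + ((k : ℤ) - s) then
      ((Nat.doubleFactorial (2 * p.2 + 1) : K) /
        ((Nat.doubleFactorial (2 * p.1 - 1) : K) * 2 ^ ((k : ℤ) - s + 1))) •
        ((scaledX c p.1 - if p.1 = s then 1 else 0) * scaledD c p.2) else 0)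
      ((r k)⁻¹ • (virXD ((k : ℤ) - s) + hd k.succPNat)) := by
    -- The dilaton shift contributes only at the pair `(s, k)`, where it produces the linear term `ℏ
    -- ∂` of the twisted operator.
    refine (((hasSum_virXD ((k : ℤ) - s)).add
      (hasSum_ite_eq (s, k) (hd k.succPNat : Weyl K))).const_smul (r k)⁻¹).congr_fun fun p => ?_
    by_cases h : (p.2 : ℤ) = p.1 + ((k : ℤ) - s)
    · rw [if_pos h, if_pos h, sub_mul, smul_sub, sub_eq_add_neg, smul_add]
      congr 1
      · rw [scaledX, scaledD, smul_mul_smul_comm, smul_smul, smul_smul]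
        congr 1
        have h1 : μ ^ ((p.2 : ℤ) - s) = μ ^ ((p.1 : ℤ) - s) * μ ^ ((k : ℤ) - s) := by
          rw [← zpow_add₀ hμ0]
          congr 1
          omega
        simp only [c, r]
        rw [h1, doubleFactorial_two_mul_add_one p.1]
        have := hF (2 * p.2 + 1)
        have := hF (2 * p.1 - 1)
        have := zpow_ne_zero ((p.1 : ℤ) - s) hμ0
        push_cast
        field_simp
      · by_cases h2 : p.1 = s
        · obtain ⟨l, m⟩ := p
          obtain rfl : l = s := h2
          obtain rfl : m = k := by dsimp only at h; omega
          rw [if_pos rfl, if_pos rfl, one_mul, scaledD, smul_smul, ← neg_smul]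
          congr 1
          -- Now `l = s` is `0` or `1`. At `0` truncated subtraction gives `0!! = 1`, in agreement
          -- with the convention `(-1)!! = 1`.
          have h3 : Nat.doubleFactorial (2 * l - 1) = 1 := by
            interval_cases l <;> rfl
          simp only [c, r]
          rw [h3]
          have := hF (2 * m + 1)
          push_cast
          field_simp
        · rw [if_neg h2, if_neg (fun h3 => h2 (congrArg Prod.fst h3)), zero_mul, smul_zero,
            smul_zero, neg_zero]
    · rw [if_neg h, if_neg h, if_neg, add_zero, smul_zero]
      rintro rfl
      exact h (by dsimp only; omega)
  have hDD : HasSum (fun p : ℕ × ℕ => if (p.1 : ℤ) + p.2 = (k : ℤ) - s - 1 then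
      ((Nat.doubleFactorial (2 * p.1 + 1) : K) * (Nat.doubleFactorial (2 * p.2 + 1) : K) /
        2 ^ ((k : ℤ) - s + 1)) • (scaledD c p.1 * scaledD c p.2) else 0)
      ((r k)⁻¹ • virDD ((k : ℤ) - s)) := by
    refine ((hasSum_virDD ((k : ℤ) - s)).const_smul (r k)⁻¹).congr_fun fun p => ?_
    split_ifs with h
    · rw [scaledD, scaledD, smul_mul_smul_comm, smul_smul]
      congr 1
      have h1 : μ ^ ((p.1 : ℤ) - s) * μ ^ ((p.2 : ℤ) - s) * μ ^ (2 * s + 1) =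
          μ ^ ((k : ℤ) - s) := by
        rw [← zpow_natCast, ← zpow_add₀ hμ0, ← zpow_add₀ hμ0]
        congr 1
        push_cast
        omega
      simp only [c, r]
      rw [← h1, hμ]
      have := hF (2 * p.1 + 1)
      have := hF (2 * p.2 + 1)
      have := zpow_ne_zero ((p.1 : ℤ) - s) hμ0
      have := zpow_ne_zero ((p.2 : ℤ) - s) hμ0
      field_simp
    · rw [smul_zero]
  have hXX : (if (k : ℤ) - s = -1 then (1 / 2 : K) • (scaledX c 0 * scaledX c 0) else 0) =
      (r k)⁻¹ • if (k : ℤ) - s = -1 then (1 / 8 : K) • (x 1 * x 1 : Weyl K) else 0 := by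
    split_ifs with h
    · obtain rfl : s = 1 := by omega
      obtain rfl : k = 0 := by omega
      rw [scaledX, smul_mul_smul_comm, smul_smul, smul_smul]
      congr 1
      simp only [c, r]
      norm_num at hμ ⊢
      field_simp
      linear_combination (-16) * hμ
    · rw [smul_zero]
  have hconst : (if (k : ℤ) - s = 0 then (1 / 16 : K) • (hbar : Weyl K) else 0) =
      (r k)⁻¹ • if (k : ℤ) - s = 0 then (1 / 16 : K) • (hbar : Weyl K) else 0 := by
    split_ifs with h
    · simp only [r]
      rw [h]
      norm_num
    · rw [smul_zero]
  rw [kdvVirasoro, hXD.tsum_eq, hDD.tsum_eq, hXX, hconst, twistedH_succPNat hs hD]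
  have := hr k
  match_scalars <;> field_simp

end TwistedAiry

end

open TwistedAiry
theorem mainTheorem8 {𝕂 : Type*} [RCLike 𝕂] (N : ℤ) (hN : -1 ≤ N) (D : ℕ+ → 𝕂) :
    -- the twisted modes represent the Heisenberg algebra
    (∀ a b : ℤ, (J a * J b - J b * J a : Weyl 𝕂) =
      if a + b + 1 = 0 then ((a : 𝕂) + 1 / 2) • hbar else 0) ∧
    -- the infinite sums that define the operators converge
    (∀ m : ℤ, Summable (fun a : ℤ => (virTerm m a : Weyl 𝕂))) ∧
    -- the operators define a quantum Airy structure
    (∃ L : VDual 𝕂 →ₗ[𝕂] Weyl 𝕂,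
      (∀ i, L (y i) = twistedH N D i) ∧
      IsQuantumAiryStructure L ∧ IsQuadratic L ∧ IsSubalgebraic L ∧
      (∀ L' : VDual 𝕂 →ₗ[𝕂] Weyl 𝕂,
        IsContinuous L' → (∀ i, L' (y i) = twistedH N D i) → L' = L)) ∧
    -- the Virasoro relations; if no such `k` exists then `i = j`
    (∀ i j k : ℕ+, (k : ℤ) = i + j + N - 1 →
      twistedH N D i * twistedH N D j - twistedH N D j * twistedH N D i =
        ((i : 𝕂) - (j : 𝕂)) • (hbar * twistedH N D k)) ∧
    -- the case `N = -1`: Kontsevich-Witten and the Airy curve, after rescaling the variables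
    (N = -1 →
      (∃ c s : ℕ → 𝕂, (∀ k, c k ≠ 0) ∧ (∀ k, s k ≠ 0) ∧
        ∀ k : ℕ, twistedH N D k.succPNat = s k • kdvVirasoro 1 c ((k : ℤ) - 1)) ∧
      (∃ c s : ℕ → 𝕂, (∀ k, c k ≠ 0) ∧ (∀ k, s k ≠ 0) ∧
        ∀ k : ℕ, twistedH N D k.succPNat = s k • trOperator (airyCurve 𝕂) c k)) ∧
    -- the case `N = 0`, `D_1 = 0`: Brézin-Gross-Witten and the Bessel curve, after rescaling
    (N = 0 → D 1 = 0 →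
      (∃ c s : ℕ → 𝕂, (∀ k, c k ≠ 0) ∧ (∀ k, s k ≠ 0) ∧
        ∀ k : ℕ, twistedH N D k.succPNat = s k • kdvVirasoro 0 c (k : ℤ)) ∧
      (∃ c s : ℕ → 𝕂, (∀ k, c k ≠ 0) ∧ (∀ k, s k ≠ 0) ∧
        ∀ k : ℕ, twistedH N D k.succPNat = s k • trOperator (besselCurve 𝕂) c k)) := by
  refine ⟨J_commutator, summable_virTerm, ⟨twistedMap N D, twistedMap_y N D,
    isQuantumAiryStructure_twistedMap hN D, isQuadratic_twistedMap hN D,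
    isSubalgebraic_twistedMap hN D, fun L' hL' h => eq_of_isContinuous hL'
      (finiteDependence_twistedMap N D).isContinuous fun i => (h i).trans (twistedMap_y N D i).symm⟩,
    twistedH_commutator hN D, ?_, ?_⟩
  · rintro rfl
    obtain ⟨μ, hμ⟩ : ∃ μ : 𝕂, μ ^ (2 * 1 + 1) = 1 / 2 := by
      -- For `s = 1` a cube root of `1/2` is needed, and the real one exists in both fields. For `s
      -- = 0` the equation is just `μ = 1/2`.
      refine ⟨(((1 / 2 : ℝ) ^ (1 / 3 : ℝ) : ℝ) : 𝕂), ?_⟩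
      rw [← RCLike.ofReal_pow, ← Real.rpow_natCast, ← Real.rpow_mul (by norm_num),
        show (1 / 3 : ℝ) * ((2 * 1 + 1 : ℕ) : ℝ) = 1 by norm_num, Real.rpow_one,
        RCLike.ofReal_div, RCLike.ofReal_one, RCLike.ofReal_ofNat]
    have h1 := exists_twistedH_eq_kdvVirasoro le_rfl (D := D) (by simp) hμ
    have h2 := exists_twistedH_eq_trOperator le_rfl (D := D) (by simp) hμ
    simp only [Nat.cast_one, mul_one] at h1 h2
    exact ⟨h1, h2⟩
  · rintro rfl hD
    have h1 := exists_twistedH_eq_kdvVirasoro zero_le_one (D := D) (fun _ => hD)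
      (μ := 1 / 2) (by norm_num)
    have h2 := exists_twistedH_eq_trOperator zero_le_one (D := D) (fun _ => hD)
      (μ := 1 / 2) (by norm_num)
    simp only [Nat.cast_zero, mul_zero, neg_zero, sub_zero] at h1 h2
    exact ⟨h1, h2⟩
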